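/- Let $p,q\in\mathbb{C}$ with $|p|<1$ and $q\neq 0$. For $x\in\mathbb{C}\setminus\{0\}$ put $$E(x)=E(x;p)=\prod_{k=0}^{\infty}(1-xp^k)\,\prod_{k=0}^{\infty}\Bigl(1-\frac{p}{x}\,p^{k}\Bigr),$$ and for $a\neq 0$ and integers $m\ge 0$ put $$(a;q,p)_m=\prod_{k=0}^{m-1}E(aq^k),\qquad (a_1,\dots,a_r;q,p)_m=(a_1;q,p)_m\cdots(a_r;q,p)_m .$$ Let $n,N\ge 0$ be integers and let $a,b,c,d,e,x_1,\dots,x_n$ be nonzero complex numbers such that $$a^2q^{N-n+2}=bcde .$$ Assume that no denominator in the identity below vanishes, that is, $E(x_i/x_j)\neq0$ and $E(ax_ix_jq^N)\neq 0$ for $1\le i<j\le n$, and $E(ax_i^2)\ne0$, $(q,aqx_i/b,aqx_i/c,aqx_i/d,aqx_i/e,ax_i^2q^{N+1};q,p)_N\neq0$ and $(aq^{2-n}/bcdx_i,aqx_i/b,aqx_i/c,aqx_i/d;q,p)_N\neq 0$ for $1\le i\le n$. Then $$\sum_{k_1,\dots,k_n=0}^N \prod_{1\leq i<j\leq n}\left(\frac{E(q^{k_i-k_j}x_i/x_j)}{E(x_i/x_j)}\,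 \frac{E(ax_ix_jq^{k_i+k_j})}{E(ax_ix_jq^N)}\right) \prod_{i=1}^n \frac{E(ax_i^2q^{2k_i})}{E(ax_i^2)}\, \frac{(ax_i^2,bx_i,cx_i,dx_i,ex_i,q^{-N};q,p)_{k_i}\,q^{ik_i}} {(q,aqx_i/b,aqx_i/c,aqx_i/d,aqx_i/e,ax_i^2q^{N+1};q,p)_{k_i}}$$ $$=\prod_{i=1}^n\frac{(aqx_i^2,aq^{2-i}/bc,aq^{2-i}/bd,aq^{2-i}/cd;q,p)_N} {(aq^{2-n}/bcdx_i,aqx_i/b,aqx_i/c,aqx_i/d;q,p)_N}.$$ Here $aq^{2-n}/bcdx_i$ stands for $aq^{2-n}/(bcdx_i)$, and similarly $aq^{2-i}/bc$ for $aq^{2-i}/(bc)$, and so on. -/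

import Mathlib

noncomputable section

/-- The infinite shifted factorial `(x; p)_∞ = ∏_{k ≥ 0} (1 - x p^k)`, for `|p| < 1`. -/
def shiftedFactorialInf (x p : ℂ) : ℂ :=
  ∏' k : ℕ, (1 - x * p ^ k)

/-- The theta function `E(x; p) = (x; p)_∞ (p / x; p)_∞`, for `x ≠ 0` and `|p| < 1`. -/
def ellE (p x : ℂ) : ℂ :=
  shiftedFactorialInf x p * shiftedFactorialInf (p / x) p

/-- The elliptic shifted factorial `(a; q, p)_m = ∏_{k=0}^{m-1} E(a q^k; p)`, for `m ≥ 0`. -/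
def ellPoch (q p a : ℂ) (m : ℕ) : ℂ :=
  ∏ k ∈ Finset.range m, ellE p (a * q ^ k)

/-- The condensed notation `(a₁, …, a_r; q, p)_m = (a₁; q, p)_m ⋯ (a_r; q, p)_m`. -/
def ellPochs (q p : ℂ) (as : List ℂ) (m : ℕ) : ℂ :=
  (as.map fun a => ellPoch q p a m).prod

end

/-! The interaction between the summation indices is a determinant. With `u i = x i * q ^ k i` and
`v i = (a * x i)⁻¹ / q ^ k i`, the product `u i * v i = a⁻¹` is the same for all `i` and `k`. An
elliptic Vandermonde evaluation (`det_ellMatrix`) then identifies the double product over pairs, up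
to elementary factors, with the determinant of the entries `(b u_i, b v_i)_j (c u_i, c
v_i)_{n-1-j}`. Row `i` involves only `k i`, so by multilinearity the multiple sum is a determinant
of single sums (`ellJacksonSum_eq_det`).

Each single sum is a Frenkel-Turaev sum with `b`, `c` replaced by `b q^j`, `c q^{n-1-j}`
(`sum_jacksonWeight_mul`). Its value is a row factor times a column factor times an entry of the
same kind of matrix, now with `u i * v i = a⁻¹ / q ^ N`. A second use of the determinant evaluation
produces the pair denominators of the summand, which cancel; `ellDetConst_div_pow_mul` compares the
two constants.

Both ingredients rest on one fact: for fixed `u * v`, any function `E(cu)E(cv)` is a combination of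
`E(au)E(av)` and `E(bu)E(bv)` (`ellE_addition`). This is Weierstrass' addition formula, obtained
here from the triple product identity. Iterated, it gives the elliptic binomial theorem
(`ellPoch_mul_ellPoch_eq_sum`), of which the Frenkel-Turaev formula is a specialization.

The argument divides by theta values that the theorem allows to vanish. The parameters are therefore
moved along a one-parameter family that keeps the balancing condition; the bad parameters are
countable, and both sides are continuous at the original point. -/

/-! ### Infinite products and the theta function -/

section InfiniteProducts

open Filter Topology

variable {p : ℂ}

lemma summable_norm_neg_mul_pow (hp : ‖p‖ < 1) (x : ℂ) : Summable fun k : ℕ => ‖-(x * p ^ k)‖ := by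
  simp only [norm_neg, norm_mul, norm_pow]
  exact (summable_geometric_of_lt_one (norm_nonneg _) hp).mul_left _

lemma multipliable_one_sub_mul_pow (hp : ‖p‖ < 1) (x : ℂ) :
    Multipliable fun k : ℕ => 1 - x * p ^ k := by
  simpa [sub_eq_add_neg] using multipliable_one_add_of_summable (summable_norm_neg_mul_pow hp x)

lemma shiftedFactorialInf_ne_zero (hp : ‖p‖ < 1) {x : ℂ} (hx : ∀ k : ℕ, x * p ^ k ≠ 1) :
    shiftedFactorialInf x p ≠ 0 := by
  have := tprod_one_add_ne_zero_of_summable (f := fun k : ℕ => -(x * p ^ k))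
    (fun k h => hx k (by linear_combination -h)) (summable_norm_neg_mul_pow hp x)
  simpa [shiftedFactorialInf, sub_eq_add_neg] using this

lemma shiftedFactorialInf_eq_mul (hp : ‖p‖ < 1) (x : ℂ) :
    shiftedFactorialInf x p = (1 - x) * shiftedFactorialInf (p * x) p := by
  have h : (fun k : ℕ => 1 - p * x * p ^ k) = fun k : ℕ => 1 - x * p ^ (k + 1) := by
    funext k; ring
  unfold shiftedFactorialInf
  rw [h, tprod_eq_zero_mul', pow_zero, mul_one]
  rw [← h]
  exact multipliable_one_sub_mul_pow hp _

lemma continuous_shiftedFactorialInf (hp : ‖p‖ < 1) :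
    Continuous fun x => shiftedFactorialInf x p := by
  rw [continuous_iff_continuousAt]
  intro x
  have h := tendsto_tprod_one_add_of_dominated_convergence (𝓕 := 𝓝 x)
    (f := fun (y : ℂ) (k : ℕ) => -(y * p ^ k)) (g := fun k : ℕ => -(x * p ^ k))
    (bound := fun k => (‖x‖ + 1) * ‖p‖ ^ k)
    ((summable_geometric_of_lt_one (norm_nonneg _) hp).mul_left _)
    (fun k => by
      have : Continuous fun y : ℂ => -(y * p ^ k) := by fun_prop
      exact this.tendsto x)
    (by
      have h1 : ∀ᶠ y in 𝓝 x, ‖y‖ < ‖x‖ + 1 :=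
        continuous_norm.continuousAt.eventually_lt continuousAt_const (by simp)
      filter_upwards [h1] with y hy k
      rw [norm_neg, norm_mul, norm_pow]
      gcongr)
  simpa [ContinuousAt, shiftedFactorialInf, sub_eq_add_neg] using h

/-- Splitting off the first factor of each infinite product leaves the same two products at `x` and
at `x⁻¹`, so only `1 - x⁻¹` against `1 - x` matters. -/
lemma ellE_inv (hp : ‖p‖ < 1) {x : ℂ} (hx : x ≠ 0) : ellE p x⁻¹ = -x⁻¹ * ellE p x := by
  unfold ellE
  rw [shiftedFactorialInf_eq_mul hp x⁻¹, shiftedFactorialInf_eq_mul hp x, div_inv_eq_mul,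
    div_eq_mul_inv]
  field_simp
  ring

lemma ellE_one (hp : ‖p‖ < 1) : ellE p 1 = 0 := by
  rw [ellE, shiftedFactorialInf_eq_mul hp 1]
  simp

lemma continuousAt_ellE (hp : ‖p‖ < 1) {x : ℂ} (hx : x ≠ 0) : ContinuousAt (ellE p) x := by
  have h := (continuous_shiftedFactorialInf hp).continuousAt (x := p / x)
  exact (continuous_shiftedFactorialInf hp).continuousAt.mul
    (h.comp (f := fun x => p / x) (continuousAt_const.div continuousAt_id hx))

/-- Each linear factor vanishes at no more than one point. Countability of the zeros is all that the
final perturbation needs; no analyticity is used. -/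
lemma countable_setOf_ellE_eq_zero (hp : ‖p‖ < 1) : {x : ℂ | ellE p x = 0}.Countable := by
  have hsub : {x : ℂ | ellE p x = 0} ⊆
      (⋃ k : ℕ, {x : ℂ | x * p ^ k = 1}) ∪ ⋃ k : ℕ, {x : ℂ | p / x * p ^ k = 1} := by
    intro x hx
    by_contra hcon
    simp only [Set.mem_union, Set.mem_iUnion, Set.mem_ofPred_eq, not_or, not_exists] at hcon
    exact mul_ne_zero (shiftedFactorialInf_ne_zero hp hcon.1)
      (shiftedFactorialInf_ne_zero hp hcon.2) hx
  refine Set.Countable.mono hsub (Set.Countable.union ?_ ?_) <;>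
    refine Set.countable_iUnion fun k => Set.Subsingleton.countable ?_
  · intro x hx y hy
    simp only [Set.mem_ofPred_eq] at hx hy
    exact mul_right_cancel₀ (right_ne_zero_of_mul_eq_one hx) (hx.trans hy.symm)
  · intro x hx y hy
    simp only [Set.mem_ofPred_eq] at hx hy
    have hx0 : x ≠ 0 := by rintro rfl; simp at hx
    have hy0 : y ≠ 0 := by rintro rfl; simp at hy
    field_simp at hx hy
    exact hx.symm.trans hy

end InfiniteProducts

/-! ### Theta series and the Jacobi triple product -/

section TripleProduct

open Filter Topology

/-- The Pascal-triangle pattern: a term at `(k, l)` is cut into a part charged to `(k - 1, l)` and a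
part charged to `(k, l - 1)`. It drives both the `q`-binomial theorem and its elliptic analogue. -/
lemma sum_antidiagonal_succ_of_split {M : Type*} [AddCommMonoid M] (N : ℕ) (g s t : ℕ → ℕ → M)
    (hg : ∀ k l, k + l = N + 1 → g k l = s k l + t k l) (hs : s 0 (N + 1) = 0)
    (ht : t (N + 1) 0 = 0) :
    ∑ kl ∈ Finset.HasAntidiagonal.antidiagonal (N + 1), g kl.1 kl.2 =
      ∑ kl ∈ Finset.HasAntidiagonal.antidiagonal N, (s (kl.1 + 1) kl.2 + t kl.1 (kl.2 + 1)) := by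
  rw [Finset.sum_congr rfl fun kl hkl => hg kl.1 kl.2 (Finset.HasAntidiagonal.mem_antidiagonal.1 hkl),
    Finset.sum_add_distrib, Finset.sum_add_distrib]
  congr 1
  · rw [Finset.Nat.sum_antidiagonal_succ (f := fun kl => s kl.1 kl.2)]
    simp [hs]
  · rw [Finset.Nat.sum_antidiagonal_succ' (f := fun kl => t kl.1 kl.2)]
    simp [ht]

/-- The finite product `(p; p)_m`. -/
noncomputable def eulerProd (p : ℂ) (m : ℕ) : ℂ := ∏ k ∈ Finset.range m, (1 - p * p ^ k)

lemma eulerProd_succ (p : ℂ) (m : ℕ) : eulerProd p (m + 1) = eulerProd p m * (1 - p ^ (m + 1)) := by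
  rw [eulerProd, Finset.prod_range_succ, ← eulerProd, pow_succ' p m]

lemma mul_pow_ne_one {p : ℂ} (hp : ‖p‖ < 1) (k : ℕ) : p * p ^ k ≠ 1 := by
  intro h
  have h1 := congrArg norm h
  rw [← pow_succ', norm_pow, norm_one] at h1
  exact (pow_lt_one₀ (norm_nonneg p) hp k.succ_ne_zero).ne h1

lemma eulerProd_ne_zero {p : ℂ} (hp : ‖p‖ < 1) (m : ℕ) : eulerProd p m ≠ 0 :=
  Finset.prod_ne_zero_iff.2 fun k _ => sub_ne_zero.2 (mul_pow_ne_one hp k).symm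

lemma tendsto_eulerProd {p : ℂ} (hp : ‖p‖ < 1) :
    Tendsto (eulerProd p) atTop (𝓝 (shiftedFactorialInf p p)) :=
  (multipliable_one_sub_mul_pow hp p).hasProd.tendsto_prod_nat

lemma prod_one_add_mul_pow_eq_sum {p : ℂ} (hp : ‖p‖ < 1) (N : ℕ) (y : ℂ) :
    ∏ k ∈ Finset.range N, (1 + y * p ^ k) =
      ∑ kl ∈ Finset.HasAntidiagonal.antidiagonal N, eulerProd p N / (eulerProd p kl.1 * eulerProd p kl.2) *
        p ^ (kl.1.choose 2) * y ^ kl.1 := by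
  induction N generalizing y with
  | zero => simp [eulerProd]
  | succ N ih =>
    -- The cut is `1 - p ^ (k + l) = (1 - p ^ k) + p ^ k * (1 - p ^ l)`.
    rw [sum_antidiagonal_succ_of_split N
      (fun k l => eulerProd p (N + 1) / (eulerProd p k * eulerProd p l) * p ^ (k.choose 2) * y ^ k)
      (fun k l => eulerProd p N * (1 - p ^ k) / (eulerProd p k * eulerProd p l) *
        p ^ (k.choose 2) * y ^ k)
      (fun k l => eulerProd p N * p ^ k * (1 - p ^ l) / (eulerProd p k * eulerProd p l) *
        p ^ (k.choose 2) * y ^ k)]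
    -- Removing the factor `1 + y` leaves the shorter product at `y * p`, hence the induction over
    -- all `y`.
    · rw [Finset.prod_range_succ']
      have h : ∏ k ∈ Finset.range N, (1 + y * p ^ (k + 1)) =
          ∏ k ∈ Finset.range N, (1 + (y * p) * p ^ k) :=
        Finset.prod_congr rfl fun k _ => by ring
      rw [h, ih, Finset.sum_mul]
      refine Finset.sum_congr rfl fun kl _ => ?_
      have h1 := eulerProd_ne_zero hp kl.1
      have h2 := eulerProd_ne_zero hp kl.2
      have h3 := eulerProd_ne_zero hp (kl.1 + 1)
      have h4 := eulerProd_ne_zero hp (kl.2 + 1)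
      rw [eulerProd_succ] at h3 h4
      have h5 := right_ne_zero_of_mul h3
      have h6 := right_ne_zero_of_mul h4
      rw [eulerProd_succ, eulerProd_succ, Nat.choose_succ_succ' kl.1 1, Nat.choose_one_right]
      generalize 1 - p ^ (kl.1 + 1) = A at h5 ⊢
      generalize 1 - p ^ (kl.2 + 1) = B at h6 ⊢
      rw [pow_add p kl.1]
      field_simp
      ring
    · intro k l hkl
      rw [eulerProd_succ, ← hkl, pow_add]
      ring
    · simp
    · simp

/-- The theta series `∑ r ^ j² y ^ j`. -/
noncomputable def thetaSeries (r y : ℂ) : ℂ := ∑' j : ℤ, r ^ (j * j) * y ^ j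

lemma summable_norm_thetaSeries_nat {r : ℂ} (hr0 : r ≠ 0) (hr : ‖r‖ < 1) {y : ℂ} (hy : y ≠ 0) :
    Summable fun n : ℕ => ‖r ^ ((n : ℤ) * n) * y ^ (n : ℤ)‖ := by
  refine summable_of_ratio_test_tendsto_lt_one (l := 0) one_pos
    (Eventually.of_forall fun n => by simp [hy, zpow_ne_zero _ (norm_ne_zero_iff.2 hr0)]) ?_
  have h : ∀ n : ℕ, ‖‖r ^ (((n + 1 : ℕ) : ℤ) * (n + 1 : ℕ)) * y ^ ((n + 1 : ℕ) : ℤ)‖‖ /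
      ‖‖r ^ ((n : ℤ) * n) * y ^ (n : ℤ)‖‖ = ‖r‖ * ‖y‖ * (‖r‖ ^ 2) ^ n := by
    intro n
    have h1 : ‖r‖ ≠ 0 := norm_ne_zero_iff.2 hr0
    have h2 : ‖y‖ ≠ 0 := norm_ne_zero_iff.2 hy
    rw [norm_norm, norm_norm, norm_mul, norm_mul, norm_zpow, norm_zpow, norm_zpow, norm_zpow,
      div_eq_iff (by positivity)]
    rw [← pow_mul, ← zpow_natCast ‖r‖ (2 * n),
      show (((n + 1 : ℕ) : ℤ) * (n + 1 : ℕ)) = (n : ℤ) * n + (2 * n : ℕ) + 1 by push_cast; ring,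
      show ((n + 1 : ℕ) : ℤ) = (n : ℤ) + 1 by push_cast; ring, zpow_add₀ h1, zpow_add₀ h1,
      zpow_add₀ h2, zpow_one, zpow_one]
    ring
  simp_rw [h]
  have h3 := tendsto_pow_atTop_nhds_zero_of_lt_one (r := ‖r‖ ^ 2) (by positivity)
    (pow_lt_one₀ (norm_nonneg r) hr two_ne_zero)
  simpa using h3.const_mul (‖r‖ * ‖y‖)

lemma summable_norm_thetaSeries {r : ℂ} (hr0 : r ≠ 0) (hr : ‖r‖ < 1) {y : ℂ} (hy : y ≠ 0) :
    Summable fun j : ℤ => ‖r ^ (j * j) * y ^ j‖ := by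
  refine Summable.of_nat_of_neg (summable_norm_thetaSeries_nat hr0 hr hy) ?_
  refine (summable_norm_thetaSeries_nat hr0 hr (inv_ne_zero hy)).congr fun n => ?_
  rw [inv_zpow, zpow_neg, neg_mul_neg]

lemma thetaSeries_sq_mul {r : ℂ} (hr0 : r ≠ 0) {y : ℂ} (hy : y ≠ 0) :
    thetaSeries r (r ^ 2 * y) = (r * y)⁻¹ * thetaSeries r y := by
  unfold thetaSeries
  rw [← tsum_mul_left, ← (Equiv.addRight (1 : ℤ)).tsum_eq (fun j => (r * y)⁻¹ * _)]
  refine tsum_congr fun j => ?_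
  simp only [Equiv.coe_addRight]
  rw [show (j + 1) * (j + 1) = j * j + 2 * j + 1 by ring, zpow_add₀ hr0, zpow_add₀ hr0,
    zpow_add₀ hy, zpow_one, zpow_one, mul_zpow, ← zpow_natCast r 2, ← zpow_mul]
  push_cast
  field_simp

/-- The bijection `(u, v) ↦ (u + v, u - v)` onto pairs of equal parity, together with
`(u, v) ↦ (u + v + 1, u - v)` onto pairs of different parity. -/
def intProdEquivSum : (ℤ × ℤ) ⊕ (ℤ × ℤ) ≃ ℤ × ℤ where
  toFun := Sum.elim (fun w => (w.1 + w.2, w.1 - w.2)) fun w => (w.1 + w.2 + 1, w.1 - w.2)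
  invFun m := if (m.1 + m.2) % 2 = 0 then .inl ((m.1 + m.2) / 2, (m.1 - m.2) / 2)
    else .inr ((m.1 + m.2) / 2, (m.1 - m.2) / 2)
  left_inv := by
    rintro (⟨u, v⟩ | ⟨u, v⟩)
    · have h : (u + v + (u - v)) % 2 = 0 := by omega
      simp only [Sum.elim_inl, h, if_true, Sum.inl.injEq, Prod.mk.injEq]
      omega
    · have h : (u + v + 1 + (u - v)) % 2 ≠ 0 := by omega
      simp only [Sum.elim_inr, h, if_false, Sum.inr.injEq, Prod.mk.injEq]
      omega
  right_inv := by
    rintro ⟨m, n⟩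
    by_cases h : (m + n) % 2 = 0
    · simp only [h, if_true, Sum.elim_inl, Prod.mk.injEq]
      omega
    · simp only [h, if_false, Sum.elim_inr, Prod.mk.injEq]
      omega

/-- Index pairs are sorted by parity: `(u + v)² + (u - v)² = 2(u² + v²)`, and `(u + v + 1)² + (u -
v)² = 2(u² + u + v² + v) + 1`. In either case the double series separates in `u` and `v`, with `r`
replaced by `r ^ 2`. -/
lemma thetaSeries_mul_thetaSeries {r : ℂ} (hr0 : r ≠ 0) (hr : ‖r‖ < 1) {y z : ℂ}
    (hy : y ≠ 0) (hz : z ≠ 0) :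
    thetaSeries r y * thetaSeries r z =
      thetaSeries (r ^ 2) (y * z) * thetaSeries (r ^ 2) (y / z) +
        r * y * thetaSeries (r ^ 2) (r ^ 2 * (y * z)) *
          thetaSeries (r ^ 2) (r ^ 2 * (y / z)) := by
  have hs0 : r ^ 2 ≠ 0 := pow_ne_zero 2 hr0
  have hs : ‖r ^ 2‖ < 1 := by
    rw [norm_pow]; exact pow_lt_one₀ (norm_nonneg r) hr two_ne_zero
  have hyz : y * z ≠ 0 := mul_ne_zero hy hz
  have hyz' : y / z ≠ 0 := div_ne_zero hy hz
  have H := fun w (hw : w ≠ 0) => summable_norm_thetaSeries hs0 hs (y := w) hw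
  have e1 := H _ hyz
  have e2 := H _ hyz'
  have o1 := H _ (mul_ne_zero hs0 hyz)
  have o2 := H _ (mul_ne_zero hs0 hyz')
  unfold thetaSeries
  rw [tsum_mul_tsum_of_summable_norm (summable_norm_thetaSeries hr0 hr hy)
    (summable_norm_thetaSeries hr0 hr hz), mul_assoc (r * y), tsum_mul_tsum_of_summable_norm e1 e2,
    tsum_mul_tsum_of_summable_norm o1 o2, ← tsum_mul_left, ← intProdEquivSum.tsum_eq]
  have hE : ∀ w : ℤ × ℤ, r ^ ((w.1 + w.2) * (w.1 + w.2)) * y ^ (w.1 + w.2) *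
      (r ^ ((w.1 - w.2) * (w.1 - w.2)) * z ^ (w.1 - w.2)) =
      (r ^ 2) ^ (w.1 * w.1) * (y * z) ^ w.1 * ((r ^ 2) ^ (w.2 * w.2) * (y / z) ^ w.2) := by
    rintro ⟨u, v⟩
    have h : r ^ ((u + v) * (u + v)) * r ^ ((u - v) * (u - v)) =
        (r ^ 2) ^ (u * u) * (r ^ 2) ^ (v * v) := by
      rw [← zpow_natCast r 2, ← zpow_mul, ← zpow_mul, ← zpow_add₀ hr0, ← zpow_add₀ hr0]
      congr 1; push_cast; ring
    dsimp only
    rw [zpow_add₀ hy, zpow_sub₀ hz, mul_zpow, div_zpow]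
    linear_combination (y ^ u * y ^ v * (z ^ u / z ^ v)) * h
  have hO : ∀ w : ℤ × ℤ, r ^ ((w.1 + w.2 + 1) * (w.1 + w.2 + 1)) * y ^ (w.1 + w.2 + 1) *
      (r ^ ((w.1 - w.2) * (w.1 - w.2)) * z ^ (w.1 - w.2)) =
      r * y * ((r ^ 2) ^ (w.1 * w.1) * (r ^ 2 * (y * z)) ^ w.1 *
        ((r ^ 2) ^ (w.2 * w.2) * (r ^ 2 * (y / z)) ^ w.2)) := by
    rintro ⟨u, v⟩
    have h : r ^ ((u + v + 1) * (u + v + 1)) * r ^ ((u - v) * (u - v)) =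
        r * ((r ^ 2) ^ (u * u) * (r ^ 2) ^ u * ((r ^ 2) ^ (v * v) * (r ^ 2) ^ v)) := by
      rw [← zpow_natCast r 2, ← zpow_mul, ← zpow_mul, ← zpow_mul, ← zpow_mul, ← zpow_add₀ hr0,
        ← zpow_add₀ hr0, ← zpow_add₀ hr0, ← zpow_add₀ hr0, ← zpow_one_add₀ hr0]
      congr 1; push_cast; ring
    dsimp only
    rw [zpow_add₀ hy, zpow_add₀ hy, zpow_one, zpow_sub₀ hz, mul_zpow (r ^ 2), mul_zpow (r ^ 2),
      mul_zpow, div_zpow]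
    linear_combination (y ^ u * y ^ v * y * (z ^ u / z ^ v)) * h
  rw [Summable.tsum_sum]
  · congr 1
    · exact tsum_congr fun w => hE w
    · exact tsum_congr fun w => hO w
  · refine (summable_mul_of_summable_norm e1 e2).congr fun w => (hE w).symm
  · refine ((summable_mul_of_summable_norm o1 o2).mul_left (r * y)).congr fun w => (hO w).symm

/-- A finite form of the triple product: the `q`-binomial theorem with `2n` factors, recentred at `k
= n`. The shift `-x / (r ^ 2) ^ n` makes the last `n` factors those of `x`, while the first `n`,
read backwards, become those of `r ^ 2 / x`. Taking `r` as a square root of the base keeps all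
exponents integral. -/
lemma prod_mul_prod_eq_sum {r x : ℂ} (hr0 : r ≠ 0) (hr : ‖r ^ 2‖ < 1) (hx : x ≠ 0) (n : ℕ) :
    (∏ k ∈ Finset.range n, (1 - x * (r ^ 2) ^ k)) *
        ∏ k ∈ Finset.range n, (1 - r ^ 2 / x * (r ^ 2) ^ k) =
      ∑ k ∈ Finset.range (2 * n + 1),
        eulerProd (r ^ 2) (2 * n) / (eulerProd (r ^ 2) k * eulerProd (r ^ 2) (2 * n - k)) *
          (r ^ (((k : ℤ) - n) * ((k : ℤ) - n)) * (-x / r) ^ ((k : ℤ) - n)) := by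
  have hr2 : r ^ 2 ≠ 0 := pow_ne_zero 2 hr0
  have hG := prod_one_add_mul_pow_eq_sum hr (2 * n) (-x / (r ^ 2) ^ n)
  rw [Finset.Nat.sum_antidiagonal_eq_sum_range_succ_mk] at hG
  have hrefl : ∀ n : ℕ, ∏ k ∈ Finset.range n, (1 + -x / (r ^ 2) ^ n * (r ^ 2) ^ k) =
      (-x / r) ^ n * r ^ (-(n * n : ℤ)) *
        ∏ k ∈ Finset.range n, (1 - r ^ 2 / x * (r ^ 2) ^ k) := by
    intro n
    rw [← Finset.prod_range_reflect]
    induction n with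
    | zero => simp
    | succ n ih =>
      rw [Finset.prod_range_succ, Finset.prod_range_succ]
      have h1 : ∏ k ∈ Finset.range n,
          (1 + -x / (r ^ 2) ^ (n + 1) * (r ^ 2) ^ (n + 1 - 1 - k)) =
          ∏ k ∈ Finset.range n, (1 + -x / (r ^ 2) ^ n * (r ^ 2) ^ (n - 1 - k)) := by
        refine Finset.prod_congr rfl fun k hk => ?_
        have hk' := Finset.mem_range.1 hk
        rw [show n + 1 - 1 - k = (n - 1 - k) + 1 by omega, pow_succ, pow_succ]
        field_simp
        ring
      rw [h1, ih, show -(((n + 1 : ℕ) : ℤ) * (n + 1 : ℕ)) = -(n * n : ℤ) - (2 * n + 1 : ℕ) by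
        push_cast; ring, zpow_sub₀ hr0, zpow_natCast]
      have h2 : n + 1 - 1 - n = 0 := by omega
      rw [h2, pow_zero, pow_succ (-x / r), pow_succ r (2 * n), pow_mul r]
      generalize ∏ k ∈ Finset.range n, (1 - r ^ 2 / x * (r ^ 2) ^ k) = P
      generalize r ^ (-(n * n : ℤ)) = R
      rw [pow_succ (r ^ 2) n]
      have h3 : (r ^ 2) ^ n ≠ 0 := pow_ne_zero _ hr2
      generalize (r ^ 2) ^ n = S at *
      generalize (-x / r) ^ n = U
      field_simp
      ring
  have hprod : ∏ k ∈ Finset.range (2 * n), (1 + -x / (r ^ 2) ^ n * (r ^ 2) ^ k) =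
      (-x / r) ^ n * r ^ (-(n * n : ℤ)) *
        ((∏ k ∈ Finset.range n, (1 - x * (r ^ 2) ^ k)) *
        ∏ k ∈ Finset.range n, (1 - r ^ 2 / x * (r ^ 2) ^ k)) := by
    rw [two_mul, Finset.prod_range_add, hrefl]
    have h1 : ∀ k, 1 + -x / (r ^ 2) ^ n * (r ^ 2) ^ (n + k) = 1 - x * (r ^ 2) ^ k := by
      intro k
      rw [pow_add]
      field_simp
      ring
    simp_rw [h1]
    ring
  have hy : -x / r ≠ 0 := div_ne_zero (neg_ne_zero.2 hx) hr0
  have hc : (-x / r) ^ n * r ^ (-(n * n : ℤ)) ≠ 0 :=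
    mul_ne_zero (pow_ne_zero _ hy) (zpow_ne_zero _ hr0)
  apply mul_left_cancel₀ hc
  rw [← hprod, hG, Finset.mul_sum]
  refine Finset.sum_congr rfl fun k _ => ?_
  have hx' : -x / (r ^ 2) ^ n = -x / r * r ^ (1 - 2 * n : ℤ) := by
    rw [zpow_sub₀ hr0, zpow_one, ← pow_mul, ← zpow_natCast r (2 * n)]
    push_cast
    field_simp
  have hch : (r ^ 2) ^ (k.choose 2) = r ^ ((k : ℤ) * (k - 1)) := by
    rw [← pow_mul, ← zpow_natCast r]
    congr 1
    have h := Nat.triangle_succ (k - 1)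
    rw [Nat.choose_two_right, Nat.mul_div_cancel' (Nat.even_mul_pred_self k).two_dvd]
    rcases k with _ | k
    · simp
    · push_cast; simp
  rw [hx', hch, mul_pow, ← zpow_natCast (-x / r) k, ← zpow_natCast (-x / r) n, zpow_sub₀ hy,
    ← zpow_natCast (r ^ _) k, ← zpow_mul,
    show ((k : ℤ) - n) * ((k : ℤ) - n) = (k * (k - 1) : ℤ) + (1 - 2 * n) * k - -(n * n : ℤ) by ring,
    zpow_sub₀ hr0 _ (-(n * n : ℤ)), zpow_add₀ hr0]
  have h1 : (-x / r) ^ (n : ℤ) ≠ 0 := zpow_ne_zero _ hy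
  have h2 : r ^ (-(n * n : ℤ)) ≠ 0 := zpow_ne_zero _ hr0
  generalize (-x / r) ^ (n : ℤ) = A at *
  generalize r ^ (-(n * n : ℤ)) = B at *
  field_simp

lemma exists_norm_eulerProd_le {p : ℂ} (hp : ‖p‖ < 1) :
    ∃ M : ℝ, ∀ m, ‖eulerProd p m‖ ≤ M ∧ ‖(eulerProd p m)⁻¹‖ ≤ M := by
  have hne : shiftedFactorialInf p p ≠ 0 := shiftedFactorialInf_ne_zero hp (mul_pow_ne_one hp)
  obtain ⟨A, hA⟩ := (tendsto_eulerProd hp).norm.bddAbove_range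
  obtain ⟨B, hB⟩ := ((tendsto_eulerProd hp).inv₀ hne).norm.bddAbove_range
  exact ⟨max A B, fun m => ⟨(hA ⟨m, rfl⟩).trans (le_max_left _ _),
    (hB ⟨m, rfl⟩).trans (le_max_right _ _)⟩⟩

/-- Jacobi's triple product identity. -/
lemma shiftedFactorialInf_mul_ellE_sq {r x : ℂ} (hr0 : r ≠ 0) (hr : ‖r‖ < 1) (hx : x ≠ 0) :
    shiftedFactorialInf (r ^ 2) (r ^ 2) * ellE (r ^ 2) x = thetaSeries r (-x / r) := by
  have hs : ‖r ^ 2‖ < 1 := by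
    rw [norm_pow]; exact pow_lt_one₀ (norm_nonneg r) hr two_ne_zero
  have hy : -x / r ≠ 0 := div_ne_zero (neg_ne_zero.2 hx) hr0
  set K := shiftedFactorialInf (r ^ 2) (r ^ 2) with hK
  have hK0 : K ≠ 0 := shiftedFactorialInf_ne_zero hs (mul_pow_ne_one hs)
  set P := eulerProd (r ^ 2) with hP
  -- The finite identity, indexed by `j = k - n` and extended by zero, so that the limit can be
  -- taken under a sum over all integers.
  let f : ℕ → ℤ → ℂ := fun n j => if j ∈ Finset.Icc (-n : ℤ) n then
    P (2 * n) / (P (n + j).toNat * P (n - j).toNat) * (r ^ (j * j) * (-x / r) ^ j) else 0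
  have hf : ∀ n, ∑' j, f n j = (∏ k ∈ Finset.range n, (1 - x * (r ^ 2) ^ k)) *
        ∏ k ∈ Finset.range n, (1 - r ^ 2 / x * (r ^ 2) ^ k) := by
    intro n
    rw [prod_mul_prod_eq_sum hr0 hs hx, tsum_eq_sum (s := Finset.Icc (-n : ℤ) n)
      (fun j hj => by simp only [f, hj, if_false])]
    refine Finset.sum_bij' (fun j _ => (n + j).toNat) (fun k _ => (k : ℤ) - n) ?_ ?_ ?_ ?_ ?_
    · intro j hj
      simp only [Finset.mem_Icc, Finset.mem_range] at *
      omega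
    · intro j hj
      simp only [Finset.mem_Icc, Finset.mem_range] at *
      omega
    · intro j hj
      simp only [Finset.mem_Icc] at *
      omega
    · intro j hj
      simp
    · intro j hj
      simp only [f, hj, if_true]
      simp only [Finset.mem_Icc] at hj
      rw [show (((n + j).toNat : ℕ) : ℤ) - n = j by omega,
        show 2 * n - (n + j).toNat = (n - j).toNat by omega]
  have hlim1 : Tendsto (fun n => ∑' j, f n j) atTop (𝓝 (ellE (r ^ 2) x)) := by
    simp_rw [hf]
    exact (multipliable_one_sub_mul_pow hs x).hasProd.tendsto_prod_nat.mul
      (multipliable_one_sub_mul_pow hs (r ^ 2 / x)).hasProd.tendsto_prod_nat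
  obtain ⟨M, hM⟩ := exists_norm_eulerProd_le hs
  have hM0 : 0 ≤ M := (norm_nonneg _).trans (hM 0).1
  -- For fixed `j` the coefficient tends to `K / (K * K)`; it is dominated uniformly because the
  -- finite products and their inverses are bounded.
  have hlim2 : Tendsto (fun n => ∑' j, f n j) atTop
      (𝓝 (∑' j : ℤ, K⁻¹ * (r ^ (j * j) * (-x / r) ^ j))) := by
    refine tendsto_tsum_of_dominated_convergence
      (bound := fun j : ℤ => M * (M * M) * ‖r ^ (j * j) * (-x / r) ^ j‖)
      ((summable_norm_thetaSeries hr0 hr hy).mul_left _) ?_ ?_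
    · intro j
      have hev : ∀ᶠ n : ℕ in atTop, P (2 * n) / (P (n + j).toNat * P (n - j).toNat) *
          (r ^ (j * j) * (-x / r) ^ j) = f n j := by
        filter_upwards [eventually_ge_atTop j.natAbs] with n hn
        have : j ∈ Finset.Icc (-n : ℤ) n := by
          rw [Finset.mem_Icc]; omega
        simp only [f, this, if_true]
      refine Tendsto.congr' hev (Tendsto.mul_const _ ?_)
      have hKK : K⁻¹ = K / (K * K) := by field_simp
      rw [hKK]
      have hT := tendsto_eulerProd hs
      refine (hT.comp ?_).div ((hT.comp ?_).mul (hT.comp ?_)) (mul_ne_zero hK0 hK0)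
      · exact tendsto_atTop_mono (fun n => by simp only [id]; omega) tendsto_id
      · refine tendsto_atTop_atTop.2 fun b => ⟨b + j.natAbs, fun n hn => by omega⟩
      · refine tendsto_atTop_atTop.2 fun b => ⟨b + j.natAbs, fun n hn => by omega⟩
    · refine Eventually.of_forall fun n j => ?_
      by_cases hj : j ∈ Finset.Icc (-n : ℤ) n
      · simp only [f, hj, if_true]
        rw [norm_mul, div_eq_mul_inv, mul_inv, norm_mul, norm_mul]
        have h1 := (hM (2 * n)).1
        have h2 := (hM (n + j).toNat).2
        have h3 := (hM (n - j).toNat).2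
        gcongr
      · simp only [f, hj, if_false, norm_zero]
        positivity
  rw [tsum_mul_left] at hlim2
  rw [tendsto_nhds_unique hlim1 hlim2, thetaSeries, mul_inv_cancel_left₀ hK0]

end TripleProduct

/-! ### Weierstrass' addition formula -/

section Weierstrass

variable {p : ℂ}

/-- After division by `x`, the right side is the 2×2 minor of the vectors `(α x / x, β x)` and `(α z
/ z, β z)`. The addition formula is then the three-term Plücker relation. The minor comes from
multiplying two theta series; `p = 0` is separate because the square root `r` must be nonzero. -/
lemma exists_ellE_mul_ellE_div (hp : ‖p‖ < 1) : ∃ (K : ℂ) (α β : ℂ → ℂ), K ≠ 0 ∧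
    ∀ x z, x ≠ 0 → z ≠ 0 →
      K * (ellE p (x * z) * ellE p (x / z)) = α x * β z - x / z * (β x * α z) := by
  by_cases hp0 : p = 0
  · subst hp0
    have h0 : ∀ x : ℂ, ellE 0 x = 1 - x := by
      intro x
      rw [ellE, shiftedFactorialInf_eq_mul hp x]
      simp [shiftedFactorialInf]
    refine ⟨1, fun x => 1 + x ^ 2, fun _ => 1, one_ne_zero, fun x z hx hz => ?_⟩
    rw [h0, h0]
    field_simp
    ring
  · obtain ⟨r, rfl⟩ : ∃ r : ℂ, r ^ 2 = p := IsAlgClosed.exists_pow_nat_eq p two_pos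
    have hr0 : r ≠ 0 := fun h => hp0 (by simp [h])
    have hr : ‖r‖ < 1 := by
      rw [norm_pow] at hp
      exact (pow_lt_one_iff_of_nonneg (norm_nonneg r) two_ne_zero).1 hp
    have hK : shiftedFactorialInf (r ^ 2) (r ^ 2) ≠ 0 :=
      shiftedFactorialInf_ne_zero hp (mul_pow_ne_one hp)
    refine ⟨shiftedFactorialInf (r ^ 2) (r ^ 2) ^ 2,
      fun x => thetaSeries (r ^ 2) (x ^ 2 / r ^ 2), fun x => thetaSeries (r ^ 2) (x ^ 2),
      pow_ne_zero 2 hK, fun x z hx hz => ?_⟩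
    have hz2 : z ^ 2 / r ^ 2 ≠ 0 := div_ne_zero (pow_ne_zero 2 hz) hp0
    have h1 := shiftedFactorialInf_mul_ellE_sq hr0 hr (mul_ne_zero hx hz)
    have h2 := shiftedFactorialInf_mul_ellE_sq hr0 hr (div_ne_zero hx hz)
    have h3 := thetaSeries_mul_thetaSeries hr0 hr
      (div_ne_zero (neg_ne_zero.2 (mul_ne_zero hx hz)) hr0)
      (div_ne_zero (neg_ne_zero.2 (div_ne_zero hx hz)) hr0)
    have h4 := thetaSeries_sq_mul hp0 hz2
    rw [← h1, ← h2, show -(x * z) / r * (-(x / z) / r) = x ^ 2 / r ^ 2 by field_simp,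
      show -(x * z) / r / (-(x / z) / r) = z ^ 2 by field_simp,
      show r ^ 2 * (x ^ 2 / r ^ 2) = x ^ 2 by field_simp,
      show r ^ 2 * z ^ 2 = (r ^ 2) ^ 2 * (z ^ 2 / r ^ 2) by field_simp, h4] at h3
    dsimp only
    have h5 : r * (-(x * z) / r) * (r ^ 2 * (z ^ 2 / r ^ 2))⁻¹ = -(x / z) := by field_simp
    linear_combination h3 + thetaSeries (r ^ 2) (x ^ 2) * thetaSeries (r ^ 2) (z ^ 2 / r ^ 2) * h5

/-- Weierstrass' addition formula. -/
lemma ellE_weierstrass (hp : ‖p‖ < 1) {x y z w : ℂ} (hx : x ≠ 0) (hy : y ≠ 0) (hz : z ≠ 0)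
    (hw : w ≠ 0) :
    ellE p (x * z) * ellE p (x / z) * (ellE p (y * w) * ellE p (y / w)) =
      ellE p (x * w) * ellE p (x / w) * (ellE p (y * z) * ellE p (y / z)) +
        y / z * (ellE p (x * y) * ellE p (x / y) * (ellE p (z * w) * ellE p (z / w))) := by
  obtain ⟨K, α, β, hK, H⟩ := exists_ellE_mul_ellE_div hp
  have h1 := H x z hx hz
  have h2 := H y w hy hw
  have h3 := H x w hx hw
  have h4 := H y z hy hz
  have h5 := H x y hx hy
  have h6 := H z w hz hw
  apply mul_left_cancel₀ (pow_ne_zero 2 hK)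
  have : ∀ A B C D E F : ℂ, K * A = (α x * β z - x / z * (β x * α z)) → 
      K * B = (α y * β w - y / w * (β y * α w)) → K * C = (α x * β w - x / w * (β x * α w)) →
      K * D = (α y * β z - y / z * (β y * α z)) → K * E = (α x * β y - x / y * (β x * α y)) →
      K * F = (α z * β w - z / w * (β z * α w)) →
      K ^ 2 * (A * B) = K ^ 2 * (C * D + y / z * (E * F)) := by
    intro A B C D E F h1 h2 h3 h4 h5 h6
    rw [show K ^ 2 * (A * B) = (K * A) * (K * B) by ring,
      show K ^ 2 * (C * D + y / z * (E * F)) = (K * C) * (K * D) + y / z * ((K * E) * (K * F)) by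
        ring, h1, h2, h3, h4, h5, h6]
    field_simp
    ring
  exact this _ _ _ _ _ _ h1 h2 h3 h4 h5 h6

/-- The addition formula in the variables `u`, `v`, `a`, `b`, `c`. -/
lemma ellE_addition (hp : ‖p‖ < 1) {u v a b c : ℂ} (hu : u ≠ 0) (hv : v ≠ 0) (ha : a ≠ 0)
    (hb : b ≠ 0) (hc : c ≠ 0) :
    ellE p (a / b) * ellE p (a * b * (u * v)) * (ellE p (c * u) * ellE p (c * v)) =
      ellE p (c / b) * ellE p (c * b * (u * v)) * (ellE p (a * u) * ellE p (a * v)) -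
        a / b * (ellE p (c / a) * ellE p (c * a * (u * v)) * (ellE p (b * u) * ellE p (b * v))) := by
  -- With `s ^ 2 = u * v`, the points `c * s`, `a * s`, `u / s`, `b * s` turn products and quotients
  -- in Weierstrass' formula into `c * u`, `c * v`, and so on.
  obtain ⟨s, hs⟩ : ∃ s : ℂ, s ^ 2 = u * v := IsAlgClosed.exists_pow_nat_eq _ two_pos
  have hs0 : s ≠ 0 := by
    rintro rfl
    exact mul_ne_zero hu hv (by rw [← hs]; simp)
  have hv' : v = s ^ 2 / u := by field_simp; rw [hs]; ring
  subst hv'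
  have hus : u / s ≠ 0 := div_ne_zero hu hs0
  have has := mul_ne_zero ha hs0
  have hbs := mul_ne_zero hb hs0
  have hcs := mul_ne_zero hc hs0
  have H := ellE_weierstrass hp (x := c * s) (y := a * s) (z := u / s) (w := b * s) hcs has hus hbs
  have e1 : ∀ t : ℂ, t * s * (u / s) = t * u := fun t => by field_simp
  have e2 : ∀ t : ℂ, t * s / (u / s) = t * (s ^ 2 / u) := fun t => by field_simp
  have e3 : ∀ t t' : ℂ, t * s * (t' * s) = t * t' * (u * (s ^ 2 / u)) := fun t t' => by field_simp
  have e4 : ∀ t t' : ℂ, t * s / (t' * s) = t / t' := fun t t' => by field_simp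
  have e5 : u / s * (b * s) = b * u := by field_simp
  have e6 : u / s / (b * s) = (b * (s ^ 2 / u))⁻¹ := by field_simp
  rw [e1, e1, e2, e2, e3, e3, e3, e4, e4, e4, e5, e6,
    ellE_inv hp (mul_ne_zero hb hv)] at H
  have e7 : a * (s ^ 2 / u) * -(b * (s ^ 2 / u))⁻¹ = -(a / b) := by field_simp
  linear_combination H + ellE p (c * a * (u * (s ^ 2 / u))) * ellE p (c / a) *
    (ellE p (b * u) * ellE p (b * (s ^ 2 / u))) * e7

end Weierstrass

/-! ### Elliptic shifted factorials -/

section ShiftedFactorials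

variable {p q : ℂ}

lemma ellPoch_zero (a : ℂ) : ellPoch q p a 0 = 1 := by simp [ellPoch]

lemma ellPoch_succ (a : ℂ) (m : ℕ) :
    ellPoch q p a (m + 1) = ellPoch q p a m * ellE p (a * q ^ m) := by
  rw [ellPoch, Finset.prod_range_succ, ← ellPoch]

lemma ellPoch_succ_self (m : ℕ) :
    ellPoch q p q (m + 1) = ellPoch q p q m * ellE p (q ^ (m + 1)) := by
  rw [ellPoch_succ, pow_succ']

lemma ellPoch_add (a : ℂ) (m n : ℕ) :
    ellPoch q p a (m + n) = ellPoch q p a m * ellPoch q p (a * q ^ m) n := by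
  simp only [ellPoch, Finset.prod_range_add, pow_add, mul_assoc]

lemma ellPoch_zpow_succ (hq : q ≠ 0) (a : ℂ) (z : ℤ) (m : ℕ) :
    ellPoch q p (a * q ^ z) (m + 1) = ellPoch q p (a * q ^ z) m * ellE p (a * q ^ (z + m)) := by
  rw [ellPoch_succ, zpow_add₀ hq, zpow_natCast, mul_assoc]

lemma ellPoch_zpow_shift (hq : q ≠ 0) (a : ℂ) (z : ℤ) (m : ℕ) :
    ellE p (a * q ^ z) * ellPoch q p (a * q ^ (z + 1)) m =
      ellPoch q p (a * q ^ z) m * ellE p (a * q ^ (z + m)) := by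
  rw [← ellPoch_zpow_succ hq, add_comm m, ellPoch_add, zpow_add_one₀ hq, pow_one, ← mul_assoc]
  simp [ellPoch]

lemma ellPoch_ne_zero {a : ℂ} {m : ℕ} (h : ∀ k : ℕ, k < m → ellE p (a * q ^ k) ≠ 0) :
    ellPoch q p a m ≠ 0 :=
  Finset.prod_ne_zero_iff.2 fun k hk => h k (Finset.mem_range.1 hk)

lemma ellPoch_zpow_ne_zero (hq : q ≠ 0) {a : ℂ} (h : ∀ z : ℤ, ellE p (a * q ^ z) ≠ 0) (z : ℤ)
    (m : ℕ) : ellPoch q p (a * q ^ z) m ≠ 0 :=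
  ellPoch_ne_zero fun k _ => by
    have := h (z + k)
    rwa [zpow_add₀ hq, zpow_natCast, ← mul_assoc] at this

lemma ellPoch_ne_zero_of_forall {a : ℂ} (h : ∀ z : ℤ, ellE p (a * q ^ z) ≠ 0) (m : ℕ) :
    ellPoch q p a m ≠ 0 :=
  ellPoch_ne_zero fun k _ => by simpa using h k

lemma ellPoch_ne_zero_of_le {a : ℂ} {m n : ℕ} (h : ellPoch q p a n ≠ 0) (hmn : m ≤ n) :
    ellPoch q p a m ≠ 0 := by
  obtain ⟨k, rfl⟩ := Nat.exists_eq_add_of_le hmn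
  rw [ellPoch_add] at h
  exact left_ne_zero_of_mul h

lemma ellE_inv_mul_zpow_ne_zero (hp : ‖p‖ < 1) (hq : q ≠ 0) {a : ℂ} (ha : a ≠ 0)
    (h : ∀ z : ℤ, ellE p (a * q ^ z) ≠ 0) (z : ℤ) : ellE p (a⁻¹ * q ^ z) ≠ 0 := by
  have h1 : a⁻¹ * q ^ z = (a * q ^ (-z))⁻¹ := by rw [mul_inv, zpow_neg, inv_inv]
  have h2 : a * q ^ (-z) ≠ 0 := mul_ne_zero ha (zpow_ne_zero _ hq)
  rw [h1, ellE_inv hp h2]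
  exact mul_ne_zero (neg_ne_zero.2 (inv_ne_zero h2)) (h _)

end ShiftedFactorials

/-! ### The elliptic binomial theorem -/

section Binomial

variable {p q : ℂ}

/-- The coefficients of the elliptic binomial theorem. -/
noncomputable def ellBinom (q p W a b c : ℂ) (k l : ℕ) : ℂ :=
  q ^ (-(k * l : ℤ)) * (ellPoch q p q (k + l) / (ellPoch q p q k * ellPoch q p q l)) *
    ((ellPoch q p (c / b) k * ellPoch q p (b * c * W * q ^ (l : ℤ)) k *
        (ellPoch q p (c / a) l * ellPoch q p (a * c * W * q ^ (k : ℤ)) l)) /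
      (ellPoch q p (a * b * W) (k + l) *
        (ellPoch q p (a / b * q ^ (-l : ℤ)) k * ellPoch q p (b / a * q ^ (-k : ℤ)) l)))

lemma ellBinom_swap (W a b c : ℂ) (k l : ℕ) :
    ellBinom q p W a b c k l = ellBinom q p W b a c l k := by
  unfold ellBinom
  rw [mul_comm (k : ℤ), add_comm k, mul_comm a b]
  ring

/-- The coefficient of the first term when `[c q^N u][c q^N v]` is expanded in
`[a q^k u][a q^k v]` and `[b q^l u][b q^l v]`, with `N = k + l`. -/
noncomputable def ellSplit (q p W a b c : ℂ) (k l : ℕ) : ℂ :=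
  ellE p (c / b * q ^ (k : ℤ)) * ellE p (b * c * W * q ^ (k + 2 * l : ℤ)) /
    (ellE p (a / b * q ^ (k - l : ℤ)) * ellE p (a * b * W * q ^ (k + l : ℤ)))

/-- The fraction of `ellBinom q p W a b c k l` that comes from `ellBinom q p W a b c (k - 1) l`
in the recurrence. -/
noncomputable def ellRatio (q p W a b c : ℂ) (k l : ℕ) : ℂ :=
  q ^ (l : ℤ) * (ellE p (q ^ k) * ellE p (a * c * W * q ^ (k - 1 : ℤ)) *
    (ellE p (b * c * W * q ^ (k + 2 * l - 1 : ℤ)) * ellE p (b / a * q ^ (-k : ℤ)))) /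
    (ellE p (q ^ (k + l)) * ellE p (a * c * W * q ^ (k + l - 1 : ℤ)) *
    (ellE p (b * c * W * q ^ (k + l - 1 : ℤ)) * ellE p (b / a * q ^ (l - k : ℤ))))

/-- The addition formula at the points `a q^k`, `b q^l`, `c q^(k+l)`. The shifts are chosen so that
the new theta factors prolong `(au, av)_k` and `(bu, bv)_l`. -/
lemma ellE_mul_ellE_eq_ellSplit (hp : ‖p‖ < 1) (hq : q ≠ 0) {u v a b c : ℂ} (hu : u ≠ 0)
    (hv : v ≠ 0) (ha : a ≠ 0) (hb : b ≠ 0) (hc : c ≠ 0)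
    (hab : ∀ z : ℤ, ellE p (a / b * q ^ z) ≠ 0)
    (habW : ∀ z : ℤ, ellE p (a * b * (u * v) * q ^ z) ≠ 0) (k l : ℕ) :
    ellE p (c * u * q ^ (k + l)) * ellE p (c * v * q ^ (k + l)) =
      ellSplit q p (u * v) a b c k l * (ellE p (a * u * q ^ k) * ellE p (a * v * q ^ k)) +
      ellSplit q p (u * v) b a c l k * (ellE p (b * u * q ^ l) * ellE p (b * v * q ^ l)) := by
  have hk : q ^ k ≠ 0 := pow_ne_zero _ hq
  have hl : q ^ l ≠ 0 := pow_ne_zero _ hq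
  have hba := ellE_inv_mul_zpow_ne_zero hp hq (div_ne_zero ha hb) hab
  rw [inv_div] at hba
  have H := ellE_addition hp hu hv (mul_ne_zero ha hk) (mul_ne_zero hb hl)
    (mul_ne_zero hc (mul_ne_zero hk hl))
  have h1 := hab (k - l)
  have h2 := habW (k + l)
  have h3 := hba (l - k)
  have h4 : ellE p (b / a * q ^ (l - k : ℤ)) =
      -(b / a * q ^ (l - k : ℤ)) * ellE p (a / b * q ^ (k - l : ℤ)) := by
    rw [show b / a * q ^ (l - k : ℤ) = (a / b * q ^ (k - l : ℤ))⁻¹ by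
      rw [mul_inv, inv_div, ← zpow_neg, neg_sub]]
    exact ellE_inv hp (mul_ne_zero (div_ne_zero ha hb) (zpow_ne_zero _ hq))
  unfold ellSplit
  rw [mul_comm b a, add_comm (l : ℤ) (k : ℤ), h4]
  have e0 : b / a * q ^ (l - k : ℤ) = b * q ^ l / (a * q ^ k) := by
    rw [zpow_sub₀ hq, zpow_natCast, zpow_natCast]; field_simp
  have e1 : a / b * q ^ (k - l : ℤ) = a * q ^ k / (b * q ^ l) := by
    rw [zpow_sub₀ hq, zpow_natCast, zpow_natCast]; field_simp
  have e2 : a * b * (u * v) * q ^ (k + l : ℤ) = a * q ^ k * (b * q ^ l) * (u * v) := by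
    rw [zpow_add₀ hq, zpow_natCast, zpow_natCast]; ring
  have e3 : c / b * q ^ (k : ℤ) = c * (q ^ k * q ^ l) / (b * q ^ l) := by
    rw [zpow_natCast]; field_simp
  have e4 : c / a * q ^ (l : ℤ) = c * (q ^ k * q ^ l) / (a * q ^ k) := by
    rw [zpow_natCast]; field_simp
  have e5 : b * c * (u * v) * q ^ (k + 2 * l : ℤ) =
      c * (q ^ k * q ^ l) * (b * q ^ l) * (u * v) := by
    rw [zpow_add₀ hq, two_mul, zpow_add₀ hq, zpow_natCast, zpow_natCast]; ring
  have e6 : a * c * (u * v) * q ^ (l + 2 * k : ℤ) =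
      c * (q ^ k * q ^ l) * (a * q ^ k) * (u * v) := by
    rw [zpow_add₀ hq, two_mul, zpow_add₀ hq, zpow_natCast, zpow_natCast]; ring
  have e7 : ∀ t : ℂ, t * q ^ (k + l) = t * (q ^ k * q ^ l) := fun t => by rw [pow_add]
  have e8 : ∀ t s r : ℂ, t * s * r = t * r * s := fun t s r => by ring
  rw [e1] at h1
  rw [e2] at h2
  rw [e0, e1, e2, e3, e4, e5, e6, e7, e7, e8 c u, e8 c v, e8 a u (q ^ k), e8 a v (q ^ k),
    e8 b u (q ^ l), e8 b v (q ^ l)]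
  generalize ellE p (a * q ^ k / (b * q ^ l)) = A at *
  generalize ellE p (a * q ^ k * (b * q ^ l) * (u * v)) = B at *
  field_simp
  field_simp at H
  linear_combination H

lemma ellRatio_add_ellRatio (hp : ‖p‖ < 1) (hq : q ≠ 0) {W a b c : ℂ} (hW : W ≠ 0)
    (ha : a ≠ 0) (hb : b ≠ 0) (hc : c ≠ 0) {k l : ℕ} (hkl : ellE p (q ^ (k + l)) ≠ 0)
    (hab : ∀ z : ℤ, ellE p (a / b * q ^ z) ≠ 0)
    (hacW : ∀ z : ℤ, ellE p (a * c * W * q ^ z) ≠ 0)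
    (hbcW : ∀ z : ℤ, ellE p (b * c * W * q ^ z) ≠ 0) :
    ellRatio q p W a b c k l + ellRatio q p W b a c l k = 1 := by
  have hk : q ^ k ≠ 0 := pow_ne_zero _ hq
  have hl : q ^ l ≠ 0 := pow_ne_zero _ hq
  have hba := ellE_inv_mul_zpow_ne_zero hp hq (div_ne_zero ha hb) hab
  rw [inv_div] at hba
  set ρ := b / a with hρ
  set σ := a * c * W / q with hσ
  have hρ0 : ρ ≠ 0 := div_ne_zero hb ha
  have hσ0 : σ ≠ 0 := div_ne_zero (mul_ne_zero (mul_ne_zero ha hc) hW) hq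
  -- In the variables `ρ = b / a` and `σ = a c W / q`, the claim is one more instance of the
  -- addition formula; what follows matches the arguments, inverting some of them.
  have H := ellE_addition hp (u := 1) (v := σ) (a := ρ * q ^ l) (b := q ^ k) (c := q ^ k * q ^ l)
    one_ne_zero hσ0 (mul_ne_zero hρ0 hl) hk (mul_ne_zero hk hl)
  have hρ' : a / b = ρ⁻¹ := by rw [hρ, inv_div]
  have f1 : ellE p (q ^ k * q ^ l / (ρ * q ^ l)) = -(q ^ k / ρ) * ellE p (ρ / q ^ k) := by
    rw [show q ^ k * q ^ l / (ρ * q ^ l) = (ρ / q ^ k)⁻¹ by field_simp,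
      ellE_inv hp (div_ne_zero hρ0 hk), inv_div]
  have f2 : ellE p (a / b * q ^ (-l : ℤ)) = -(ρ * q ^ l)⁻¹ * ellE p (ρ * q ^ l) := by
    rw [hρ', zpow_neg, zpow_natCast, ← mul_inv, ellE_inv hp (mul_ne_zero hρ0 hl)]
  have f3 : ellE p (a / b * q ^ (k - l : ℤ)) =
      -(q ^ k / (ρ * q ^ l)) * ellE p (ρ * q ^ l / q ^ k) := by
    rw [hρ', zpow_sub₀ hq, zpow_natCast, zpow_natCast,
      show ρ⁻¹ * (q ^ k / q ^ l) = (ρ * q ^ l / q ^ k)⁻¹ by field_simp,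
      ellE_inv hp (div_ne_zero (mul_ne_zero hρ0 hl) hk), inv_div]
  have e1 : ∀ m n : ℕ, q ^ (m + n - 1 : ℤ) = q ^ m * q ^ n / q := fun m n => by
    rw [zpow_sub_one₀ hq, zpow_add₀ hq, zpow_natCast, zpow_natCast]; rfl
  have e2 : ∀ m n : ℕ, q ^ (m + 2 * n - 1 : ℤ) = q ^ m * q ^ n * q ^ n / q := fun m n => by
    rw [zpow_sub_one₀ hq, zpow_add₀ hq, two_mul, zpow_add₀ hq, zpow_natCast, zpow_natCast]
    ring
  have e3 : ∀ m : ℕ, q ^ (m - 1 : ℤ) = q ^ m / q := fun m => by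
    rw [zpow_sub_one₀ hq, zpow_natCast]; rfl
  have e4 : ∀ t : ℂ, a * c * W * (t / q) = σ * t := fun t => by rw [hσ]; ring
  have e5 : ∀ t : ℂ, b * c * W * (t / q) = ρ * σ * t := fun t => by rw [hσ, hρ]; field_simp
  have h1 := hacW (k + l - 1)
  have h2 := hbcW (k + l - 1)
  have h3 := hba (l - k)
  have e6 : ρ * q ^ (l - k : ℤ) = ρ * q ^ l / q ^ k := by
    rw [zpow_sub₀ hq, zpow_natCast, zpow_natCast, mul_div_assoc]
  have e7 : ρ * q ^ (-k : ℤ) = ρ / q ^ k := by rw [zpow_neg, zpow_natCast]; rfl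
  unfold ellRatio
  rw [add_comm l k, add_comm (l : ℤ) (k : ℤ), f2, f3]
  simp only [e1, e2, e3, e4, e5] at h1 h2 ⊢
  rw [e6] at h3 ⊢
  rw [e7, zpow_natCast, zpow_natCast]
  rw [f1] at H
  rw [pow_add] at hkl ⊢
  rw [show q ^ k * q ^ l / q ^ k = q ^ l by field_simp,
    show ρ * q ^ l * q ^ k * (1 * σ) = ρ * σ * (q ^ k * q ^ l) by ring,
    show q ^ k * q ^ l * q ^ k * (1 * σ) = σ * (q ^ l * q ^ k * q ^ k) by ring,
    show q ^ k * q ^ l * (ρ * q ^ l) * (1 * σ) = ρ * σ * (q ^ k * q ^ l * q ^ l) by ring,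
    show q ^ k * q ^ l * σ = σ * (q ^ k * q ^ l) by ring,
    show q ^ k * σ = σ * q ^ k by ring,
    show ρ * q ^ l * σ = ρ * σ * q ^ l by ring, mul_one, mul_one, mul_one] at H
  generalize ellE p (q ^ k * q ^ l) = X1 at *
  generalize ellE p (σ * (q ^ k * q ^ l)) = X2 at *
  generalize ellE p (ρ * σ * (q ^ k * q ^ l)) = X3 at *
  generalize ellE p (ρ * q ^ l / q ^ k) = X4 at *
  generalize ellE p (q ^ k) = Y1 at *
  generalize ellE p (q ^ l) = Y2 at *
  generalize ellE p (σ * q ^ k) = Y3 at *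
  generalize ellE p (ρ * σ * q ^ l) = Y4 at *
  generalize ellE p (ρ * σ * (q ^ k * q ^ l * q ^ l)) = Y5 at *
  generalize ellE p (σ * (q ^ l * q ^ k * q ^ k)) = Y6 at *
  generalize ellE p (ρ * q ^ l) = Y7 at *
  generalize ellE p (ρ / q ^ k) = Y8 at *
  field_simp
  field_simp at H
  linear_combination -H

/-- One half of the Pascal recurrence; the other half follows by the symmetry `ellBinom_swap`. Only
shifts of factorials are compared, and no addition formula enters. -/
lemma ellBinom_mul_ellSplit (hq : q ≠ 0) {W a b c : ℂ} {k l : ℕ}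
    (hqN : ellPoch q p q (k + l + 1) ≠ 0)
    (hab : ∀ z : ℤ, ellE p (a / b * q ^ z) ≠ 0)
    (hba : ∀ z : ℤ, ellE p (b / a * q ^ z) ≠ 0)
    (habW : ∀ z : ℤ, ellE p (a * b * W * q ^ z) ≠ 0)
    (hacW : ∀ z : ℤ, ellE p (a * c * W * q ^ z) ≠ 0)
    (hbcW : ∀ z : ℤ, ellE p (b * c * W * q ^ z) ≠ 0) :
    ellBinom q p W a b c (k + 1) l * ellRatio q p W a b c (k + 1) l =
      ellBinom q p W a b c k l * ellSplit q p W a b c k l := by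
  have hk1 : ellPoch q p q (k + 1) ≠ 0 := ellPoch_ne_zero_of_le hqN (by omega)
  have hl1 : ellPoch q p q l ≠ 0 := ellPoch_ne_zero_of_le hqN (by omega)
  rw [ellPoch_succ_self] at hqN hk1
  have hk2 := left_ne_zero_of_mul hk1
  have hk3 := right_ne_zero_of_mul hk1
  have hN1 := left_ne_zero_of_mul hqN
  have hN2 := right_ne_zero_of_mul hqN
  have s1 := ellPoch_zpow_succ (p := p) hq (c / b) 0 k
  have s2 := ellPoch_zpow_succ (p := p) hq (b * c * W) l k
  have s3 := ellPoch_zpow_shift (p := p) hq (a * c * W) k l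
  have s4 := ellPoch_zpow_succ (p := p) hq (a * b * W) 0 (k + l)
  have s5 := ellPoch_zpow_succ (p := p) hq (a / b) (-l) k
  have s6 := ellPoch_zpow_shift (p := p) hq (b / a) (-(k + 1)) l
  simp only [zpow_zero, mul_one, zero_add] at s1 s4
  rw [show (-((k : ℤ) + 1) + 1) = -k by ring, show -((k : ℤ) + 1) + l = l - (k + 1) by ring] at s6
  rw [show -(l : ℤ) + k = k - l by ring] at s5
  rw [add_comm (l : ℤ) (k : ℤ)] at s2
  have t1 := hacW k
  have t2 := hacW (k + l)
  have t3 := hbcW (k + l)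
  have t4 := hba (l - (k + 1))
  have t5 := hab (k - l)
  have t6 := habW (k + l)
  have t7 := hba (-(k + 1))
  have u1 := ellPoch_ne_zero_of_forall habW (k + l)
  have u2 := ellPoch_zpow_ne_zero hq hab (-l) k
  have u3 := ellPoch_zpow_ne_zero hq hba (-k) l
  have u4 := ellPoch_zpow_ne_zero hq hba (-(k + 1)) l
  have s3' : ellPoch q p (a * c * W * q ^ ((k : ℤ) + 1)) l =
      ellPoch q p (a * c * W * q ^ (k : ℤ)) l * ellE p (a * c * W * q ^ (k + l : ℤ)) /
        ellE p (a * c * W * q ^ (k : ℤ)) := by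
    rw [eq_div_iff t1, ← s3]; ring
  have s6' : ellPoch q p (b / a * q ^ (-((k : ℤ) + 1))) l =
      ellE p (b / a * q ^ (-((k : ℤ) + 1))) * ellPoch q p (b / a * q ^ (-k : ℤ)) l /
        ellE p (b / a * q ^ (l - (k + 1) : ℤ)) := by
    rw [eq_div_iff t4, s6]
  have z1 : q ^ (-(((k : ℤ) + 1) * l)) = q ^ (-(k * l : ℤ)) / q ^ (l : ℤ) := by
    rw [← zpow_sub₀ hq]; congr 1; ring
  unfold ellBinom ellRatio ellSplit
  rw [show k + 1 + l = k + l + 1 by ring, ellPoch_succ_self (k + l), ellPoch_succ_self k]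
  push_cast at *
  rw [show (k : ℤ) + 1 - 1 = k by ring, show (k : ℤ) + 1 + l - 1 = k + l by ring,
    show (k : ℤ) + 1 + 2 * l - 1 = k + 2 * l by ring, s1, s2, s4, s5, s3', s6', z1]
  have z2 : q ^ (l : ℤ) ≠ 0 := zpow_ne_zero _ hq
  generalize q ^ (l : ℤ) = Q at *
  generalize q ^ (-(k * l : ℤ)) = R at *
  generalize ellPoch q p q (k + l) = A1 at *
  generalize ellPoch q p q k = A2 at *
  generalize ellPoch q p q l = A3 at *
  generalize ellE p (q ^ (k + 1)) = A4 at *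
  generalize ellE p (q ^ (k + l + 1)) = A5 at *
  generalize ellE p (a * c * W * q ^ (k : ℤ)) = B1 at *
  generalize ellE p (a * c * W * q ^ (k + l : ℤ)) = B2 at *
  generalize ellE p (b * c * W * q ^ (k + l : ℤ)) = B3 at *
  generalize ellE p (b / a * q ^ (l - (k + 1) : ℤ)) = B4 at *
  generalize ellE p (a / b * q ^ (k - l : ℤ)) = B5 at *
  generalize ellE p (a * b * W * q ^ (k + l : ℤ)) = B6 at *
  generalize ellE p (b / a * q ^ (-(k + 1) : ℤ)) = B7 at *
  generalize ellPoch q p (a * b * W) (k + l) = C1 at *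
  generalize ellPoch q p (a / b * q ^ (-l : ℤ)) k = C2 at *
  generalize ellPoch q p (b / a * q ^ (-k : ℤ)) l = C3 at *
  generalize ellPoch q p (a * c * W * q ^ (k : ℤ)) l = C4 at *
  generalize ellE p (b * c * W * q ^ (k + 2 * l : ℤ)) = C5 at *
  generalize ellE p (c / b * q ^ (k : ℤ)) = C6 at *
  clear s1 s2 s3 s4 s5 s6 s3' s6' z1 u4 hab hba habW hacW hbcW hk1 hqN
  field_simp

/-- The elliptic binomial theorem. -/
lemma ellPoch_mul_ellPoch_eq_sum (hp : ‖p‖ < 1) (hq : q ≠ 0) {u v a b c : ℂ} (hu : u ≠ 0)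
    (hv : v ≠ 0) (ha : a ≠ 0) (hb : b ≠ 0) (hc : c ≠ 0) {N : ℕ} (hqN : ellPoch q p q N ≠ 0)
    (hab : ∀ z : ℤ, ellE p (a / b * q ^ z) ≠ 0)
    (habW : ∀ z : ℤ, ellE p (a * b * (u * v) * q ^ z) ≠ 0)
    (hacW : ∀ z : ℤ, ellE p (a * c * (u * v) * q ^ z) ≠ 0)
    (hbcW : ∀ z : ℤ, ellE p (b * c * (u * v) * q ^ z) ≠ 0) :
    ellPoch q p (c * u) N * ellPoch q p (c * v) N =
      ∑ kl ∈ Finset.HasAntidiagonal.antidiagonal N, ellBinom q p (u * v) a b c kl.1 kl.2 *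
        (ellPoch q p (a * u) kl.1 * ellPoch q p (a * v) kl.1 *
          (ellPoch q p (b * u) kl.2 * ellPoch q p (b * v) kl.2)) := by
  have hba := ellE_inv_mul_zpow_ne_zero hp hq (div_ne_zero ha hb) hab
  rw [inv_div] at hba
  have hbaW : ∀ z : ℤ, ellE p (b * a * (u * v) * q ^ z) ≠ 0 := by rwa [mul_comm b a]
  induction N with
  | zero => simp [ellPoch, ellBinom]
  | succ N ih =>
    specialize ih (ellPoch_ne_zero_of_le hqN N.le_succ)
    have hqN' : ellE p (q ^ (N + 1)) ≠ 0 := by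
      rw [ellPoch_succ_self] at hqN
      exact right_ne_zero_of_mul hqN
    let F : ℕ → ℕ → ℂ := fun k l => ellPoch q p (a * u) k * ellPoch q p (a * v) k *
      (ellPoch q p (b * u) l * ellPoch q p (b * v) l)
    have h0 : ellE p (q ^ 0) = 0 := by rw [pow_zero, ellE_one hp]
    rw [sum_antidiagonal_succ_of_split N (fun k l => ellBinom q p (u * v) a b c k l * F k l)
      (fun k l => ellBinom q p (u * v) a b c k l * ellRatio q p (u * v) a b c k l * F k l)
      (fun k l => ellBinom q p (u * v) a b c k l * ellRatio q p (u * v) b a c l k * F k l)]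
    · rw [ellPoch_succ, ellPoch_succ, mul_mul_mul_comm, ih, Finset.sum_mul]
      refine Finset.sum_congr rfl fun kl hkl => ?_
      obtain ⟨k, l⟩ := kl
      have hkl' : k + l = N := Finset.HasAntidiagonal.mem_antidiagonal.1 hkl
      subst hkl'
      have hlk : ellPoch q p q (l + k + 1) ≠ 0 := by rwa [add_comm l k]
      -- The last factor of `(cu, cv)_{N+1}` is expanded anew for each `(k, l)`, with shifts adapted
      -- to that summand.
      rw [ellE_mul_ellE_eq_ellSplit hp hq hu hv ha hb hc hab habW,
        ellBinom_mul_ellSplit hq hqN hab hba habW hacW hbcW,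
        ellBinom_swap _ a b c k (l + 1),
        ellBinom_mul_ellSplit hq hlk hba hab hbaW hbcW hacW,
        ellBinom_swap _ b a c l k]
      simp only [F, ellPoch_succ]
      ring
    · intro k l hkl
      have hkl1 : ellE p (q ^ (k + l)) ≠ 0 := by rwa [hkl]
      have := ellRatio_add_ellRatio hp hq (mul_ne_zero hu hv) ha hb hc hkl1 hab hacW hbcW
      linear_combination -(ellBinom q p (u * v) a b c k l * F k l) * this
    -- The boundary terms carry the factor `E(q ^ 0) = E(1) = 0`.
    · simp [ellRatio, ellE_one hp]
    · simp [ellRatio, ellE_one hp]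

end Binomial

/-! ### The Frenkel-Turaev summation -/

section FrenkelTuraev

variable {p q : ℂ}

/-- The power `q ^ (-m (m + 1) / 2)`. -/
noncomputable def invTriPow (q : ℂ) (m : ℕ) : ℂ := ∏ i ∈ Finset.range m, (q ^ (i + 1))⁻¹

lemma invTriPow_ne_zero (hq : q ≠ 0) (m : ℕ) : invTriPow q m ≠ 0 :=
  Finset.prod_ne_zero_iff.2 fun _ _ => inv_ne_zero (pow_ne_zero _ hq)

lemma invTriPow_sq_mul (hq : q ≠ 0) (m : ℕ) : invTriPow q m ^ 2 * ((q ^ m) ^ m * q ^ m) = 1 := by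
  induction m with
  | zero => simp [invTriPow]
  | succ m ih =>
    have h : q ^ m ≠ 0 := pow_ne_zero _ hq
    rw [invTriPow, Finset.prod_range_succ, ← invTriPow, pow_succ (q ^ (m + 1)), pow_succ q m,
      mul_pow (q ^ m) q m]
    field_simp
    linear_combination ih

lemma invTriPow_add (hq : q ≠ 0) (k l : ℕ) :
    invTriPow q (k + l) * q ^ (k * l) = invTriPow q k * invTriPow q l := by
  induction l with
  | zero => simp [invTriPow]
  | succ l ih =>
    rw [← add_assoc, invTriPow, Finset.prod_range_succ, ← invTriPow, invTriPow.eq_1 q (l + 1),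
      Finset.prod_range_succ, ← invTriPow, ← mul_assoc, ← ih, mul_add, mul_one, pow_add q (k * l),
      pow_succ q (k + l), pow_add q k l, pow_succ q l]
    field_simp

/-- Reverse the order of the factors and invert each argument by `ellE_inv`; the monomials so
produced collect in `invTriPow`. -/
lemma ellPoch_div_pow (hp : ‖p‖ < 1) (hq : q ≠ 0) {x : ℂ} (hx : x ≠ 0) (m : ℕ) :
    ellPoch q p (x / q ^ m) m = (-x) ^ m * invTriPow q m * ellPoch q p (q / x) m := by
  have hc : (-x) ^ m = ∏ _i ∈ Finset.range m, -x := by simp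
  rw [ellPoch, ← Finset.prod_range_reflect, invTriPow, ellPoch, hc, ← Finset.prod_mul_distrib,
    ← Finset.prod_mul_distrib]
  refine Finset.prod_congr rfl fun i hi => ?_
  have hi' := Finset.mem_range.1 hi
  have h0 : q / x * q ^ i ≠ 0 := mul_ne_zero (div_ne_zero hq hx) (pow_ne_zero _ hq)
  have h1 : x / q ^ m * q ^ (m - 1 - i) = (q / x * q ^ i)⁻¹ := by
    obtain ⟨j, rfl⟩ : ∃ j, m = j + i + 1 := ⟨m - 1 - i, by omega⟩
    rw [show j + i + 1 - 1 - i = j by omega, pow_add, pow_add]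
    field_simp
  rw [h1, ellE_inv hp h0, pow_succ]
  field_simp

/-- Both sides group the factors of the single string `(A)_{2k+l+1}` in different ways. This is the
source of the very-well-poised factor `E(A q^{2k}) / E(A)`. -/
lemma ellPoch_vwp (A : ℂ) (k l : ℕ) :
    ellE p A * ellPoch q p (q * A) (k + l) * ellPoch q p (q * A * (q ^ k * q ^ l)) k =
      ellPoch q p A k * ellPoch q p (A * q ^ k) k * ellE p (A * q ^ (2 * k)) *
        ellPoch q p (q * A * q ^ (2 * k)) l := by
  have h1 : ∀ (x : ℂ) (m : ℕ), ellPoch q p x (1 + m) = ellE p x * ellPoch q p (q * x) m := by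
    intro x m
    rw [ellPoch_add, pow_one, mul_comm q]
    simp [ellPoch]
  have h2 : ellPoch q p A (1 + (k + l + k)) =
      ellE p A * ellPoch q p (q * A) (k + l) * ellPoch q p (q * A * (q ^ k * q ^ l)) k := by
    rw [h1, ellPoch_add, pow_add]; ring
  have h3 : ellPoch q p A (1 + (k + l + k)) =
      ellPoch q p A k * ellPoch q p (A * q ^ k) k * ellE p (A * q ^ (2 * k)) *
        ellPoch q p (q * A * q ^ (2 * k)) l := by
    rw [show 1 + (k + l + k) = k + (k + (1 + l)) by ring, ellPoch_add, ellPoch_add, h1, mul_assoc A,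
      ← pow_add, ← two_mul, mul_assoc q]
    ring
  rw [← h2, h3]

/-- Bookkeeping of the signs and monomials released by the reversals in `frenkelTuraev_term`. The
balancing condition is what leaves exactly `q ^ k`. -/
lemma frenkelTuraev_scalar (hq : q ≠ 0) {A β γ δ ε : ℂ} (hA : A ≠ 0) (hε : ε ≠ 0) {k l : ℕ}
    (hbal : A ^ 2 * (q * (q ^ k * q ^ l)) = β * γ * δ * ε) :
    q ^ (-(k * l : ℤ)) * ((-(q / ε)) ^ k * invTriPow q k) *
        ((-A⁻¹) ^ (k + l) * invTriPow q (k + l)) =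
      (-(β / A)) ^ k * invTriPow q k * ((-(γ / A)) ^ k * invTriPow q k) *
        ((-(δ / A)) ^ k * invTriPow q k) * ((-(q ^ l)⁻¹) ^ k * invTriPow q k) *
        ((-(A * q ^ (2 * k))⁻¹) ^ l * invTriPow q l) * q ^ k := by
  have h1 := invTriPow_sq_mul hq k
  have h2 := invTriPow_add hq k l
  have h3 : (A ^ 2) ^ k * (q ^ k * ((q ^ k) ^ k * q ^ (k * l))) = (β * γ * δ * ε) ^ k := by
    rw [← hbal, mul_pow, mul_pow, mul_pow, ← pow_mul q l, mul_comm l k]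
  have hM : q ^ (k * l) ≠ 0 := pow_ne_zero _ hq
  have hz : q ^ (-(k * l : ℤ)) = (q ^ (k * l))⁻¹ := by
    rw [zpow_neg]; exact_mod_cast rfl
  have hN : invTriPow q (k + l) = invTriPow q k * invTriPow q l / q ^ (k * l) := by
    rw [eq_div_iff hM, h2]
  have hs : ((-1 : ℂ) ^ k) ^ 2 = 1 := by rw [← pow_mul, mul_comm, pow_mul]; simp
  rw [hz, hN]
  simp only [neg_pow (q / ε), neg_pow A⁻¹, neg_pow (β / A), neg_pow (γ / A), neg_pow (δ / A),
    neg_pow (q ^ l)⁻¹, neg_pow (A * q ^ (2 * k))⁻¹, div_pow, inv_pow, mul_pow, ← pow_mul q l,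
    ← pow_mul q (2 * k), mul_comm l k, show 2 * k * l = k * l * 2 by ring, pow_mul q (k * l) 2,
    pow_add]
  simp only [mul_pow] at h3
  rw [show (A ^ 2) ^ k = (A ^ k) ^ 2 by rw [← pow_mul, ← pow_mul, mul_comm]] at h3
  have a1 : A ^ k ≠ 0 := pow_ne_zero _ hA
  have a2 : A ^ l ≠ 0 := pow_ne_zero _ hA
  have a3 : ε ^ k ≠ 0 := pow_ne_zero _ hε
  have a4 := invTriPow_ne_zero hq k
  have a5 := invTriPow_ne_zero hq l
  have a6 : q ^ k ≠ 0 := pow_ne_zero _ hq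
  generalize (q ^ k) ^ k = KK at *
  generalize q ^ (k * l) = M at *
  generalize q ^ k = K at *
  generalize (-1 : ℂ) ^ k = s at *
  generalize (-1 : ℂ) ^ l = t at *
  generalize invTriPow q k = G at *
  generalize invTriPow q l = G' at *
  generalize A ^ k = A1 at *
  generalize A ^ l = A2 at *
  generalize β ^ k = B at *
  generalize γ ^ k = C at *
  generalize δ ^ k = D at *
  generalize ε ^ k = E at *
  have key : A1 ^ 2 * M = B * C * D * E * G ^ 2 := by
    rw [← h3]
    linear_combination (-(A1 ^ 2 * M)) * h1
  field_simp
  linear_combination (s ^ 2 * t) * key - (s ^ 2 * t * G ^ 2 * B * C * D * E) * hs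

/-- In the binomial theorem take `u = β`, `v = γ`, `a = 1`, `b = A⁻¹ / q ^ N` and `c = δ b`. Then `c
/ b` yields `(δ)_k`, the reversal of `(b c W q^l)_k` yields `(ε)_k` by balancing, and `a / b * q ^
(-l)` equals `A q^k`. The remaining prefactor depends only on `N = k + l`. -/
lemma frenkelTuraev_term (hp : ‖p‖ < 1) (hq : q ≠ 0) {A β γ δ ε b : ℂ} (hA : A ≠ 0) (hβ : β ≠ 0)
    (hγ : γ ≠ 0) (hδ : δ ≠ 0) (hε : ε ≠ 0) {k l : ℕ}
    (hbal : A ^ 2 * (q * (q ^ k * q ^ l)) = β * γ * δ * ε)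
    (hb : b = A⁻¹ / (q ^ k * q ^ l))
    (hqN : ellPoch q p q (k + l) ≠ 0)
    (hAz : ∀ z : ℤ, ellE p (A * q ^ z) ≠ 0)
    (hAβ : ∀ z : ℤ, ellE p (A / β * q ^ z) ≠ 0) (hAγ : ∀ z : ℤ, ellE p (A / γ * q ^ z) ≠ 0)
    (hAδ : ∀ z : ℤ, ellE p (A / δ * q ^ z) ≠ 0) (hAε : ∀ z : ℤ, ellE p (A / ε * q ^ z) ≠ 0)
    (hβγ : ellPoch q p (b * (β * γ)) (k + l) ≠ 0) :
    ellBinom q p (β * γ) 1 b (δ * b) k l *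
        (ellPoch q p β k * ellPoch q p γ k * (ellPoch q p (b * β) l * ellPoch q p (b * γ) l)) =
      ellPoch q p (b * δ) (k + l) * ellPoch q p (A * q / ε) (k + l) /
          (ellPoch q p (b * (β * γ)) (k + l) * ellPoch q p b (k + l)) *
          (ellPoch q p (b * β) (k + l) * ellPoch q p (b * γ) (k + l)) *
        (ellE p (A * q ^ (2 * k)) / ellE p A *
          (ellPoch q p A k * ellPoch q p β k * ellPoch q p γ k * ellPoch q p δ k * ellPoch q p ε k *
              ellPoch q p (q ^ (-(k + l : ℤ))) k * q ^ k /
            (ellPoch q p q k * ellPoch q p (A * q / β) k * ellPoch q p (A * q / γ) k *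
              ellPoch q p (A * q / δ) k * ellPoch q p (A * q / ε) k *
              ellPoch q p (A * q ^ (k + l + 1)) k))) := by
  have hK : q ^ k ≠ 0 := pow_ne_zero _ hq
  have hL : q ^ l ≠ 0 := pow_ne_zero _ hq
  have hscal := frenkelTuraev_scalar hq hA hε hbal
  have P1 : ∀ t : ℂ, t ≠ 0 → ellPoch q p (b * t) (k + l) =
      ellPoch q p (b * t) l * ((-(t / A)) ^ k * invTriPow q k * ellPoch q p (A * q / t) k) := by
    intro t ht
    rw [add_comm, ellPoch_add, show b * t * q ^ l = t / A / q ^ k by rw [hb]; field_simp,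
      ellPoch_div_pow hp hq (div_ne_zero ht hA), show q / (t / A) = A * q / t by field_simp]
  have P2 : ellPoch q p q (k + l) = ellPoch q p q l * ellPoch q p (q * q ^ l) k := by
    rw [add_comm, ellPoch_add]
  have P2' : ellPoch q p (q ^ (-(k + l : ℤ))) k =
      (-(q ^ l)⁻¹) ^ k * invTriPow q k * ellPoch q p (q * q ^ l) k := by
    rw [show q ^ (-(k + l : ℤ)) = (q ^ l)⁻¹ / q ^ k by
      rw [zpow_neg, zpow_add₀ hq, zpow_natCast, zpow_natCast]; field_simp,
      ellPoch_div_pow hp hq (inv_ne_zero hL), show q / (q ^ l)⁻¹ = q * q ^ l by field_simp]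
  have P3 : ellPoch q p (b * (δ * b) * (β * γ) * q ^ (l : ℤ)) k =
      (-(q / ε)) ^ k * invTriPow q k * ellPoch q p ε k := by
    rw [show b * (δ * b) * (β * γ) * q ^ (l : ℤ) = q / ε / q ^ k by
      rw [hb, zpow_natCast]; field_simp; linear_combination -hbal,
      ellPoch_div_pow hp hq (div_ne_zero hq hε), show q / (q / ε) = ε by field_simp]
  have hacW : 1 * (δ * b) * (β * γ) = A * q / ε := by
    rw [hb]; field_simp; linear_combination -hbal
  have P4 : ellPoch q p (A * q / ε) (k + l) = ellPoch q p (A * q / ε) k *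
      ellPoch q p (1 * (δ * b) * (β * γ) * q ^ (k : ℤ)) l := by
    rw [ellPoch_add, hacW, zpow_natCast]
  have P5 : ellPoch q p b (k + l) =
      (-A⁻¹) ^ (k + l) * invTriPow q (k + l) * ellPoch q p (q * A) (k + l) := by
    rw [hb, ← pow_add, ellPoch_div_pow hp hq (inv_ne_zero hA), div_inv_eq_mul]
  have P5' : ellPoch q p (b / 1 * q ^ (-k : ℤ)) l =
      (-(A * q ^ (2 * k))⁻¹) ^ l * invTriPow q l * ellPoch q p (q * A * q ^ (2 * k)) l := by
    have h0 : A * q ^ (2 * k) ≠ 0 := mul_ne_zero hA (pow_ne_zero _ hq)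
    rw [show b / 1 * q ^ (-k : ℤ) = (A * q ^ (2 * k))⁻¹ / q ^ l by
      rw [hb, zpow_neg, zpow_natCast, two_mul, pow_add]; field_simp,
      ellPoch_div_pow hp hq (inv_ne_zero h0), div_inv_eq_mul, mul_assoc q]
  have P6 := ellPoch_vwp (p := p) (q := q) A k l
  have P7 : ellPoch q p (1 / b * q ^ (-l : ℤ)) k = ellPoch q p (A * q ^ k) k := by
    congr 1
    rw [hb, zpow_neg, zpow_natCast]; field_simp
  have P8 : A * q ^ (k + l + 1) = q * A * (q ^ k * q ^ l) := by rw [pow_add, pow_add]; ring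
  have P9 : δ * b / b = δ := by
    have : b ≠ 0 := by
      rw [hb]; exact div_ne_zero (inv_ne_zero hA) (mul_ne_zero hK hL)
    field_simp
  have n0 : ellE p A ≠ 0 := by simpa using hAz 0
  have hshift : ∀ (t : ℂ), (∀ z : ℤ, ellE p (A / t * q ^ z) ≠ 0) → ∀ m,
      ellPoch q p (A * q / t) m ≠ 0 := by
    intro t ht m
    have := ellPoch_zpow_ne_zero hq ht 1 m
    rwa [zpow_one, div_mul_eq_mul_div] at this
  have n1 := hshift β hAβ k
  have n2 := hshift γ hAγ k
  have n3 := hshift δ hAδ k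
  have n4 := hshift ε hAε k
  have n5 : ellPoch q p (q * A * (q ^ k * q ^ l)) k ≠ 0 := by
    rw [← P8, ← zpow_natCast]
    exact ellPoch_zpow_ne_zero hq hAz _ _
  have n6 : ellPoch q p (q * A) (k + l) ≠ 0 := by
    have := ellPoch_zpow_ne_zero hq hAz 1 (k + l)
    rwa [zpow_one, mul_comm] at this
  have n7 : ellPoch q p (A * q ^ k) k ≠ 0 := by
    rw [← zpow_natCast]
    exact ellPoch_zpow_ne_zero hq hAz _ _
  have n8 : ellPoch q p (q * A * q ^ (2 * k)) l ≠ 0 := by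
    rw [show q * A * q ^ (2 * k) = A * q ^ (2 * k + 1 : ℕ) by rw [pow_succ]; ring, ← zpow_natCast]
    exact ellPoch_zpow_ne_zero hq hAz _ _
  have n9 : ellPoch q p q k ≠ 0 := ellPoch_ne_zero_of_le hqN (by omega)
  have n10 : ellPoch q p q l ≠ 0 := ellPoch_ne_zero_of_le hqN (by omega)
  have n11 : (-A⁻¹) ^ (k + l) * invTriPow q (k + l) ≠ 0 :=
    mul_ne_zero (pow_ne_zero _ (neg_ne_zero.2 (inv_ne_zero hA))) (invTriPow_ne_zero hq _)
  have n12 : (-(A * q ^ (2 * k))⁻¹) ^ l * invTriPow q l ≠ 0 :=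
    mul_ne_zero (pow_ne_zero _ (neg_ne_zero.2 (inv_ne_zero (mul_ne_zero hA (pow_ne_zero _ hq)))))
      (invTriPow_ne_zero hq _)
  unfold ellBinom
  rw [P9, show δ * b / 1 = b * δ by ring, show 1 * b * (β * γ) = b * (β * γ) by ring, P3, P5', P7,
    P1 β hβ, P1 γ hγ, P1 δ hδ, P2, P2', P4, P5, P8]
  clear P1 P2 P2' P3 P4 P5 P5' P7 P8 P9 hshift hAz hAβ hAγ hAδ hAε hbal hacW hb hqN
  generalize ellPoch q p (1 * (δ * b) * (β * γ) * q ^ (k : ℤ)) l = X1 at *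
  generalize ellPoch q p (b * (β * γ)) (k + l) = X2 at *
  generalize ellPoch q p (b * β) l = X3 at *
  generalize ellPoch q p (b * γ) l = X4 at *
  generalize ellPoch q p (b * δ) l = X5 at *
  generalize (-(q / ε)) ^ k * invTriPow q k = S1 at *
  generalize (-A⁻¹) ^ (k + l) * invTriPow q (k + l) = S2 at *
  generalize (-(β / A)) ^ k * invTriPow q k = S3 at *
  generalize (-(γ / A)) ^ k * invTriPow q k = S4 at *
  generalize (-(δ / A)) ^ k * invTriPow q k = S5 at *
  generalize (-(q ^ l)⁻¹) ^ k * invTriPow q k = S6 at *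
  generalize (-(A * q ^ (2 * k))⁻¹) ^ l * invTriPow q l = S7 at *
  generalize q ^ (-(k * l : ℤ)) = S8 at *
  generalize ellPoch q p (q * A * (q ^ k * q ^ l)) k = Y1 at *
  generalize ellPoch q p (q * A * q ^ (2 * k)) l = Y2 at *
  generalize ellPoch q p (q * A) (k + l) = Y3 at *
  generalize ellPoch q p (A * q ^ k) k = Y4 at *
  generalize ellE p (A * q ^ (2 * k)) = Y5 at *
  generalize ellE p A = Y6 at *
  generalize ellPoch q p A k = Y7 at *
  generalize ellPoch q p (A * q / β) k = Z1 at *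
  generalize ellPoch q p (A * q / γ) k = Z2 at *
  generalize ellPoch q p (A * q / δ) k = Z3 at *
  generalize ellPoch q p (A * q / ε) k = Z4 at *
  generalize ellPoch q p q k = Z5 at *
  generalize ellPoch q p q l = Z6 at *
  generalize ellPoch q p (q * q ^ l) k = Z7 at *
  generalize ellPoch q p β k = Z8 at *
  generalize ellPoch q p γ k = Z9 at *
  generalize ellPoch q p δ k = W1 at *
  generalize ellPoch q p ε k = W2 at *
  generalize q ^ k = K at *
  field_simp
  have e1 : S8 * S1 * (Y3 * Y6 * Y1) * S2 =
      (Y7 * Y4 * Y5 * Y2) * (S3 * S4 * S5 * S6 * S7 * K) := by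
    rw [← hscal, ← P6]; ring
  linear_combination (Z7 * W2 * X1 * Z8 * Z9 * X3 * X4 * W1 * X5) * e1

/-- The Frenkel-Turaev summation formula. -/
lemma frenkelTuraev (hp : ‖p‖ < 1) (hq : q ≠ 0) {A β γ δ ε : ℂ} (hA : A ≠ 0) (hβ : β ≠ 0)
    (hγ : γ ≠ 0) (hδ : δ ≠ 0) (hε : ε ≠ 0) {N : ℕ}
    (hbal : A ^ 2 * q ^ (N + 1) = β * γ * δ * ε)
    (hqN : ellPoch q p q N ≠ 0)
    (hAz : ∀ z : ℤ, ellE p (A * q ^ z) ≠ 0) (hεz : ∀ z : ℤ, ellE p (ε * q ^ z) ≠ 0)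
    (hAβ : ∀ z : ℤ, ellE p (A / β * q ^ z) ≠ 0) (hAγ : ∀ z : ℤ, ellE p (A / γ * q ^ z) ≠ 0)
    (hAδ : ∀ z : ℤ, ellE p (A / δ * q ^ z) ≠ 0) (hAε : ∀ z : ℤ, ellE p (A / ε * q ^ z) ≠ 0)
    (hβγ : ∀ z : ℤ, ellE p (β * γ / A * q ^ z) ≠ 0) :
    ∑ k ∈ Finset.range (N + 1), ellE p (A * q ^ (2 * k)) / ellE p A *
          (ellPoch q p A k * ellPoch q p β k * ellPoch q p γ k * ellPoch q p δ k * ellPoch q p ε k *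
              ellPoch q p (q ^ (-(N : ℤ))) k * q ^ k /
            (ellPoch q p q k * ellPoch q p (A * q / β) k * ellPoch q p (A * q / γ) k *
              ellPoch q p (A * q / δ) k * ellPoch q p (A * q / ε) k *
              ellPoch q p (A * q ^ (N + 1)) k)) =
      ellPoch q p (A * q) N * ellPoch q p (A * q / (β * γ)) N * ellPoch q p (A * q / (β * δ)) N *
          ellPoch q p (A * q / (γ * δ)) N /
        (ellPoch q p (A * q / β) N * ellPoch q p (A * q / γ) N * ellPoch q p (A * q / δ) N *
          ellPoch q p (A * q / (β * γ * δ)) N) := by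
  let f : ℕ → ℂ := fun k => ellE p (A * q ^ (2 * k)) / ellE p A *
    (ellPoch q p A k * ellPoch q p β k * ellPoch q p γ k * ellPoch q p δ k * ellPoch q p ε k *
        ellPoch q p (q ^ (-(N : ℤ))) k * q ^ k /
      (ellPoch q p q k * ellPoch q p (A * q / β) k * ellPoch q p (A * q / γ) k *
        ellPoch q p (A * q / δ) k * ellPoch q p (A * q / ε) k *
        ellPoch q p (A * q ^ (N + 1)) k))
  change ∑ k ∈ Finset.range (N + 1), f k = _
  set b := A⁻¹ / q ^ N with hb
  have hN : q ^ N ≠ 0 := pow_ne_zero _ hq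
  have hb0 : b ≠ 0 := div_ne_zero (inv_ne_zero hA) hN
  have hbz : b = A⁻¹ * q ^ (-N : ℤ) := by rw [hb, zpow_neg, zpow_natCast]; rfl
  have hεi := ellE_inv_mul_zpow_ne_zero hp hq hε hεz
  have hacW : 1 * (δ * b) * (β * γ) = A / ε * q := by
    rw [hb]; field_simp; rw [pow_succ] at hbal; linear_combination -hbal
  have hbcW : b * (δ * b) * (β * γ) = ε⁻¹ * q ^ (1 - N : ℤ) := by
    rw [hb, zpow_sub₀ hq, zpow_one, zpow_natCast]
    field_simp; rw [pow_succ] at hbal; linear_combination -hbal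
  have hbin := ellPoch_mul_ellPoch_eq_sum (a := 1) (b := b) (c := δ * b) hp hq hβ hγ one_ne_zero
    hb0 (mul_ne_zero hδ hb0) hqN
    (fun z => by
      rw [show 1 / b * q ^ z = A * q ^ (N + z) by
        rw [hb, zpow_add₀ hq, zpow_natCast]; field_simp]
      exact hAz _)
    (fun z => by
      rw [show 1 * b * (β * γ) * q ^ z = β * γ / A * q ^ (-N + z) by
        rw [hbz, zpow_add₀ hq]; field_simp]
      exact hβγ _)
    (fun z => by
      rw [hacW, mul_assoc, ← zpow_one_add₀ hq]
      exact hAε _)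
    (fun z => by
      rw [hbcW, mul_assoc, ← zpow_add₀ hq]
      exact hεi _)
  have hβγN : ellPoch q p (b * (β * γ)) N ≠ 0 := by
    rw [show b * (β * γ) = β * γ / A * q ^ (-N : ℤ) by rw [hbz]; field_simp]
    exact ellPoch_zpow_ne_zero hq hβγ _ _
  have hterm : ∀ kl ∈ Finset.HasAntidiagonal.antidiagonal N,
      ellBinom q p (β * γ) 1 b (δ * b) kl.1 kl.2 * (ellPoch q p (1 * β) kl.1 *
        ellPoch q p (1 * γ) kl.1 * (ellPoch q p (b * β) kl.2 * ellPoch q p (b * γ) kl.2)) =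
      ellPoch q p (b * δ) N * ellPoch q p (A * q / ε) N /
          (ellPoch q p (b * (β * γ)) N * ellPoch q p b N) *
          (ellPoch q p (b * β) N * ellPoch q p (b * γ) N) *
        f kl.1 := by
    rintro ⟨k, l⟩ hkl
    have hkl' : k + l = N := Finset.HasAntidiagonal.mem_antidiagonal.1 hkl
    subst hkl'
    rw [one_mul, one_mul]
    refine frenkelTuraev_term hp hq hA hβ hγ hδ hε ?_ ?_ hqN hAz hAβ hAγ hAδ hAε hβγN
    · rw [← hbal, pow_succ, pow_add]; ring
    · rw [hb, pow_add]
  rw [Finset.sum_congr rfl hterm, ← Finset.mul_sum,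
    Finset.Nat.sum_antidiagonal_eq_sum_range_succ_mk] at hbin
  dsimp only at hbin
  rw [Nat.succ_eq_add_one] at hbin
  -- Reversal brings the factors with base `b` to the form `A q / t`; their monomials cancel in the
  -- final identity.
  have R : ∀ t : ℂ, t ≠ 0 → ellPoch q p (b * t) N =
      (-(t / A)) ^ N * invTriPow q N * ellPoch q p (A * q / t) N := by
    intro t ht
    rw [show b * t = t / A / q ^ N by rw [hb]; field_simp,
      ellPoch_div_pow hp hq (div_ne_zero ht hA), show q / (t / A) = A * q / t by field_simp]
  have R1 : ellPoch q p b N = (-(1 / A)) ^ N * invTriPow q N * ellPoch q p (A * q) N := by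
    have := R 1 one_ne_zero
    rwa [mul_one, div_one] at this
  have R2 : A * q / ε = b * (β * γ * δ) := by
    rw [show A * q / ε = A / ε * q by ring, ← hacW]; ring
  have hshift : ∀ (t : ℂ), (∀ z : ℤ, ellE p (A / t * q ^ z) ≠ 0) →
      ellPoch q p (A * q / t) N ≠ 0 := by
    intro t ht
    have := ellPoch_zpow_ne_zero hq ht 1 N
    rwa [zpow_one, div_mul_eq_mul_div] at this
  have n1 := hshift β hAβ
  have n2 := hshift γ hAγ
  have n3 := hshift δ hAδ
  have n4 := hshift ε hAε
  have n5 : ellPoch q p (A * q) N ≠ 0 := by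
    have := ellPoch_zpow_ne_zero hq hAz 1 N
    rwa [zpow_one] at this
  have hβγ0 := mul_ne_zero hβ hγ
  have n6 : ellPoch q p (A * q / (β * γ)) N ≠ 0 := by
    have := R _ hβγ0
    rw [this] at hβγN
    exact right_ne_zero_of_mul hβγN
  have n7 : ellPoch q p (A * q / (β * γ * δ)) N ≠ 0 := by
    have := R _ (mul_ne_zero hβγ0 hδ)
    rw [R2, this] at n4
    exact right_ne_zero_of_mul n4
  have R3 : ellPoch q p (A * q / ε) N = (-(β * γ * δ / A)) ^ N * invTriPow q N *
      ellPoch q p (A * q / (β * γ * δ)) N := by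
    rw [R2, R _ (mul_ne_zero hβγ0 hδ)]
  rw [show δ * b * β = b * (β * δ) by ring, show δ * b * γ = b * (γ * δ) by ring,
    R _ (mul_ne_zero hβ hδ), R _ (mul_ne_zero hγ hδ), R _ hδ, R _ hβ, R _ hγ, R _ hβγ0, R1,
    R3] at hbin
  have g0 := invTriPow_ne_zero hq N
  have hs0 : ((-1 : ℂ) ^ N) ≠ 0 := pow_ne_zero _ (by simp)
  simp only [neg_pow (_ / A), div_pow, mul_pow, one_pow] at hbin
  have m1 : β ^ N ≠ 0 := pow_ne_zero _ hβ
  have m2 : γ ^ N ≠ 0 := pow_ne_zero _ hγ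
  have m3 : δ ^ N ≠ 0 := pow_ne_zero _ hδ
  have m4 : A ^ N ≠ 0 := pow_ne_zero _ hA
  generalize ∑ k ∈ Finset.range (N + 1), f k = S at hbin ⊢
  generalize ellPoch q p (A * q / β) N = X1 at *
  generalize ellPoch q p (A * q / γ) N = X2 at *
  generalize ellPoch q p (A * q / δ) N = X3 at *
  generalize ellPoch q p (A * q) N = X4 at *
  generalize ellPoch q p (A * q / (β * γ)) N = X5 at *
  generalize ellPoch q p (A * q / (β * γ * δ)) N = X6 at *
  generalize ellPoch q p (A * q / (β * δ)) N = X7 at *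
  generalize ellPoch q p (A * q / (γ * δ)) N = X8 at *
  generalize invTriPow q N = G at *
  generalize (-1 : ℂ) ^ N = s at *
  generalize A ^ N = A1 at *
  generalize β ^ N = B at *
  generalize γ ^ N = C at *
  generalize δ ^ N = D at *
  clear hβγN R R1 R2 R3 hterm hshift hAz hεz hAβ hAγ hAδ hAε hβγ hbal hεi hacW hbcW hqN
  field_simp at hbin ⊢
  linear_combination -hbin

end FrenkelTuraev

/-! ### An elliptic Vandermonde determinant -/

section Determinant

variable {p q : ℂ}

/-- The matrix `(b u_i, b v_i)_j (c u_i, c v_i)_{n - 1 - j}`. -/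
noncomputable def ellMatrix (q p b c : ℂ) {n : ℕ} (u v : Fin n → ℂ) : Matrix (Fin n) (Fin n) ℂ :=
  Matrix.of fun i j => ellPoch q p (b * u i) j * ellPoch q p (b * v i) j *
    (ellPoch q p (c * u i) (n - 1 - j) * ellPoch q p (c * v i) (n - 1 - j))

/-- The constant in the evaluation of the determinant of `ellMatrix`. -/
noncomputable def ellDetConst (q p W b c : ℂ) (n : ℕ) : ℂ :=
  ∏ m ∈ Finset.range n, ∏ j ∈ Finset.range m, (-(c * W * q ^ (m - 1 - j)) *
    ellE p (b / c * q ^ (2 * j + 1 - m : ℤ)) * ellE p (b * c * W * q ^ (m - 1 : ℤ)))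

lemma prod_prod_Ioi_succ {M : Type*} [CommMonoid M] {m : ℕ} (f : Fin (m + 1) → Fin (m + 1) → M) :
    ∏ i, ∏ j ∈ Finset.Ioi i, f i j =
      (∏ j : Fin m, f 0 j.succ) * ∏ i : Fin m, ∏ j ∈ Finset.Ioi i, f i.succ j.succ := by
  rw [Fin.prod_univ_succ, Fin.prod_Ioi_zero]
  simp_rw [Fin.prod_Ioi_succ]

/-- The addition formula with base points `u₀⁻¹` and `c q^r`. The first term vanishes at `u = u₀`,
so subtracting a multiple of the preceding column clears the row of `u₀`. -/
lemma ellMatrix_succ_column (hp : ‖p‖ < 1) (hq : q ≠ 0) {W b c u v u₀ v₀ : ℂ} (hb : b ≠ 0)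
    (hc : c ≠ 0) (hu : u ≠ 0) (hv : v ≠ 0) (hu₀ : u₀ ≠ 0) (huv : u * v = W) (huv₀ : u₀ * v₀ = W)
    {j r : ℕ} (hcu : ellE p (c * u₀ * q ^ r) ≠ 0) (hcv : ellE p (c * v₀ * q ^ r) ≠ 0) :
    ellE p (b * u * q ^ j) * ellE p (b * v * q ^ j) =
      -(u₀ * c * q ^ r) * ellE p (b / c * q ^ (j - r : ℤ)) * ellE p (b * c * W * q ^ (j + r : ℤ)) /
          (ellE p (c * u₀ * q ^ r) * ellE p (c * v₀ * q ^ r)) *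
          (ellE p (u / u₀) * ellE p (v / u₀)) +
        -(ellE p (b * q ^ j * u₀) * ellE p (b * q ^ j * v₀)) * (-1) /
          (ellE p (c * u₀ * q ^ r) * ellE p (c * v₀ * q ^ r)) *
          (ellE p (c * u * q ^ r) * ellE p (c * v * q ^ r)) := by
  have hj : q ^ j ≠ 0 := pow_ne_zero _ hq
  have hr : q ^ r ≠ 0 := pow_ne_zero _ hq
  have H := ellE_addition hp hu hv (inv_ne_zero hu₀) (mul_ne_zero hc hr) (mul_ne_zero hb hj)
  have e1 : u₀⁻¹ / (c * q ^ r) = (c * u₀ * q ^ r)⁻¹ := by field_simp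
  have e2 : u₀⁻¹ * (c * q ^ r) * (u * v) = c * v₀ * q ^ r := by rw [huv, ← huv₀]; field_simp
  have e3 : b * q ^ j / (c * q ^ r) = b / c * q ^ (j - r : ℤ) := by
    rw [zpow_sub₀ hq, zpow_natCast, zpow_natCast]; field_simp
  have e4 : b * q ^ j * (c * q ^ r) * (u * v) = b * c * W * q ^ (j + r : ℤ) := by
    rw [huv, zpow_add₀ hq, zpow_natCast, zpow_natCast]; ring
  have e5 : b * q ^ j / u₀⁻¹ = b * q ^ j * u₀ := by rw [div_inv_eq_mul]
  have e6 : b * q ^ j * u₀⁻¹ * (u * v) = b * q ^ j * v₀ := by rw [huv, ← huv₀]; field_simp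
  rw [e1, e2, e3, e4, e5, e6, ellE_inv hp (mul_ne_zero (mul_ne_zero hc hu₀) hr),
    inv_mul_eq_div, inv_mul_eq_div, show b * q ^ j * u = b * u * q ^ j by ring,
    show b * q ^ j * v = b * v * q ^ j by ring, show c * q ^ r * u = c * u * q ^ r by ring,
    show c * q ^ r * v = c * v * q ^ r by ring] at H
  generalize ellE p (c * u₀ * q ^ r) = X at *
  generalize ellE p (c * v₀ * q ^ r) = Y at *
  generalize ellE p (b * u * q ^ j) * ellE p (b * v * q ^ j) = T at *
  generalize ellE p (b / c * q ^ (j - r : ℤ)) = X1 at *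
  generalize ellE p (b * c * W * q ^ (j + r : ℤ)) = X2 at *
  generalize ellE p (u / u₀) = X3 at *
  generalize ellE p (v / u₀) = X4 at *
  generalize ellE p (b * q ^ j * u₀) = X5 at *
  generalize ellE p (b * q ^ j * v₀) = X6 at *
  generalize ellE p (c * u * q ^ r) = X7 at *
  generalize ellE p (c * v * q ^ r) = X8 at *
  field_simp at H ⊢
  linear_combination -H

/-- As for Vandermonde: column operations clear row `0` except for its first entry. What remains has
a scalar `κ j` in each column and `E(u_i / u_0) E(v_i / u_0)` in each row, and is otherwise the same
matrix for the remaining variables. -/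
lemma det_ellMatrix (hp : ‖p‖ < 1) (hq : q ≠ 0) {W b c : ℂ} (hb : b ≠ 0) (hc : c ≠ 0) {n : ℕ}
    (u v : Fin n → ℂ) (hu : ∀ i, u i ≠ 0) (hv : ∀ i, v i ≠ 0) (huv : ∀ i, u i * v i = W)
    (hcu : ∀ i, ∀ z : ℤ, ellE p (c * u i * q ^ z) ≠ 0)
    (hcv : ∀ i, ∀ z : ℤ, ellE p (c * v i * q ^ z) ≠ 0) :
    (ellMatrix q p b c u v).det = ellDetConst q p W b c n * (∏ i, (u i)⁻¹ ^ (n - 1 - i : ℕ)) *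
      ∏ i, ∏ j ∈ Finset.Ioi i, (ellE p (u i / u j) * ellE p (u i / v j)) := by
  induction n with
  | zero => simp [ellDetConst]
  | succ m ih =>
    let κ : Fin m → ℂ := fun j => -(u 0 * c * q ^ (m - 1 - j : ℕ)) *
      ellE p (b / c * q ^ (2 * j + 1 - m : ℤ)) * ellE p (b * c * W * q ^ (m - 1 : ℤ)) /
        (ellE p (c * u 0 * q ^ (m - 1 - j : ℕ)) * ellE p (c * v 0 * q ^ (m - 1 - j : ℕ)))
    let μ : Fin m → ℂ := fun j =>
      -(ellE p (b * q ^ (j : ℕ) * u 0) * ellE p (b * q ^ (j : ℕ) * v 0)) * (-1) /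
          (ellE p (c * u 0 * q ^ (m - 1 - j : ℕ)) * ellE p (c * v 0 * q ^ (m - 1 - j : ℕ)))
    let G : Fin (m + 1) → Fin m → ℂ := fun i j => κ j * (ellE p (u i / u 0) * ellE p (v i / u 0) *
      (ellPoch q p (b * u i) j * ellPoch q p (b * v i) j *
        (ellPoch q p (c * u i) (m - 1 - j) * ellPoch q p (c * v i) (m - 1 - j))))
    let B : Matrix (Fin (m + 1)) (Fin (m + 1)) ℂ := Matrix.of fun i =>
      Fin.cons (ellMatrix q p b c u v i 0) (G i)
    have hdet : (ellMatrix q p b c u v).det = B.det := by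
      refine Matrix.det_eq_of_forall_col_eq_smul_add_pred μ (fun i => by simp [B]) ?_
      intro i j
      have hj := j.2
      have hcol := ellMatrix_succ_column hp hq hb hc (hu i) (hv i) (hu 0) (huv i) (huv 0)
        (j := j) (r := m - 1 - j) (by simpa using hcu 0 ((m - 1 - j : ℕ) : ℤ))
        (by simpa using hcv 0 ((m - 1 - j : ℕ) : ℤ))
      have z1 : ((j : ℕ) : ℤ) - (m - 1 - j : ℕ) = 2 * j + 1 - m := by omega
      have z2 : ((j : ℕ) : ℤ) + (m - 1 - j : ℕ) = m - 1 := by omega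
      rw [z1, z2] at hcol
      have h1 : m + 1 - 1 - (j + 1 : ℕ) = m - 1 - j := by omega
      have h2 : m + 1 - 1 - (j : ℕ) = m - 1 - j + 1 := by omega
      simp only [ellMatrix, Matrix.of_apply, B, Fin.cons_succ, Fin.val_succ, Fin.val_castSucc, G, h1,
        h2, ellPoch_succ]
      change _ = κ j * _ + μ j * _
      change _ = κ j * _ + μ j * _ at hcol
      linear_combination (ellPoch q p (b * u i) j * ellPoch q p (b * v i) j *
        (ellPoch q p (c * u i) (m - 1 - j) * ellPoch q p (c * v i) (m - 1 - j))) * hcol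
    have hB : B.det = ellMatrix q p b c u v 0 0 * ((∏ j, κ j) *
        ((∏ i : Fin m, (ellE p (u i.succ / u 0) * ellE p (v i.succ / u 0))) *
          (ellMatrix q p b c (fun i : Fin m => u i.succ) (fun i : Fin m => v i.succ)).det)) := by
      rw [Matrix.det_succ_row_zero, Fin.sum_univ_succ, Finset.sum_eq_zero, add_zero,
        ← Matrix.det_mul_column, ← Matrix.det_mul_row]
      · simp [B, G, ellMatrix, Matrix.submatrix, Matrix.of_apply]
      · intro j _
        simp [B, G, div_self (hu 0), ellE_one hp]
    have hIH := ih (fun i => u i.succ) (fun i => v i.succ) (fun i => hu _) (fun i => hv _)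
      (fun i => huv _) (fun i => hcu _) (fun i => hcv _)
    have hC : ellDetConst q p W b c (m + 1) = ellDetConst q p W b c m *
        ∏ j : Fin m, (-(c * W * q ^ (m - 1 - j : ℕ)) * ellE p (b / c * q ^ (2 * j + 1 - m : ℤ)) *
          ellE p (b * c * W * q ^ (m - 1 : ℤ))) := by
      rw [ellDetConst, Finset.prod_range_succ, ← ellDetConst]
      congr 1
      exact Finset.prod_range _
    have hpoch : ∀ t : ℂ, ellPoch q p t m = ∏ j : Fin m, ellE p (t * q ^ (m - 1 - j : ℕ)) := by
      intro t
      rw [ellPoch, ← Finset.prod_range_reflect, Finset.prod_range]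
    -- The corner entry `(c u_0, c v_0)_m` cancels the denominators of all the `κ j`.
    have h00 : ellMatrix q p b c u v 0 0 * ∏ j, κ j = ∏ j : Fin m,
        (-(u 0 * c * q ^ (m - 1 - j : ℕ)) * ellE p (b / c * q ^ (2 * j + 1 - m : ℤ)) *
          ellE p (b * c * W * q ^ (m - 1 : ℤ))) := by
      simp only [ellMatrix, Matrix.of_apply, Fin.val_zero, ellPoch_zero, one_mul, Nat.sub_zero,
        Nat.add_sub_cancel, hpoch]
      rw [← Finset.prod_mul_distrib, ← Finset.prod_mul_distrib]
      refine Finset.prod_congr rfl fun j _ => ?_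
      refine mul_div_cancel₀ _ (mul_ne_zero ?_ ?_)
      · simpa using hcu 0 ((m - 1 - j : ℕ) : ℤ)
      · simpa using hcv 0 ((m - 1 - j : ℕ) : ℤ)
    -- Inverting both arguments costs `u_i v_i / u_0²`, which is independent of `i` because `u_i v_i
    -- = W`.
    have hflip : ∀ i : Fin m, ellE p (u i.succ / u 0) * ellE p (v i.succ / u 0) =
        W / u 0 ^ 2 * (ellE p (u 0 / u i.succ) * ellE p (u 0 / v i.succ)) := by
      intro i
      rw [← inv_div (u 0), ← inv_div (u 0) (v i.succ), ellE_inv hp (div_ne_zero (hu 0) (hu _)),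
        ellE_inv hp (div_ne_zero (hu 0) (hv _)), inv_div, inv_div, ← huv i.succ]
      field_simp [hu 0]
    have hflip' : ∏ i : Fin m, (ellE p (u i.succ / u 0) * ellE p (v i.succ / u 0)) =
        (∏ _i : Fin m, W / u 0 ^ 2) *
          ∏ i : Fin m, (ellE p (u 0 / u i.succ) * ellE p (u 0 / v i.succ)) := by
      rw [Finset.prod_congr rfl fun i _ => hflip i, Finset.prod_mul_distrib]
    rw [hdet, hB, hIH, ← mul_assoc, h00, hC, prod_prod_Ioi_succ, Fin.prod_univ_succ, hflip']
    have hexp : ∀ i : Fin m, m - (i.succ : ℕ) = m - 1 - i := by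
      intro i
      rw [Fin.val_succ]
      omega
    simp only [hexp, Fin.val_zero, Nat.sub_zero, Nat.add_sub_cancel]
    have hscal : (∏ j : Fin m, (-(u 0 * c * q ^ (m - 1 - j : ℕ)) *
        ellE p (b / c * q ^ (2 * j + 1 - m : ℤ)) * ellE p (b * c * W * q ^ (m - 1 : ℤ)))) *
        ∏ _i : Fin m, W / u 0 ^ 2 = (∏ j : Fin m, (-(c * W * q ^ (m - 1 - j : ℕ)) *
          ellE p (b / c * q ^ (2 * j + 1 - m : ℤ)) * ellE p (b * c * W * q ^ (m - 1 : ℤ)))) *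
        (u 0)⁻¹ ^ m := by
      have : (u 0)⁻¹ ^ m = ∏ _i : Fin m, (u 0)⁻¹ := by simp
      rw [this, ← Finset.prod_mul_distrib, ← Finset.prod_mul_distrib]
      refine Finset.prod_congr rfl fun j _ => ?_
      field_simp [hu 0]
    linear_combination ((∏ i : Fin m, (ellE p (u 0 / u i.succ) * ellE p (u 0 / v i.succ))) *
      (ellDetConst q p W b c m * (∏ i : Fin m, (u i.succ)⁻¹ ^ (m - 1 - i : ℕ)) *
        ∏ i : Fin m, ∏ j ∈ Finset.Ioi i,
          (ellE p (u i.succ / u j.succ) * ellE p (u i.succ / v j.succ)))) * hscal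

lemma ellDetConst_ne_zero (hq : q ≠ 0) {W b c : ℂ} (hW : W ≠ 0) (hc : c ≠ 0)
    (hbc : ∀ z : ℤ, ellE p (b / c * q ^ z) ≠ 0) (hbcW : ∀ z : ℤ, ellE p (b * c * W * q ^ z) ≠ 0)
    (n : ℕ) : ellDetConst q p W b c n ≠ 0 :=
  Finset.prod_ne_zero_iff.2 fun _ _ => Finset.prod_ne_zero_iff.2 fun _ _ =>
    mul_ne_zero (mul_ne_zero (neg_ne_zero.2 (mul_ne_zero (mul_ne_zero hc hW)
      (pow_ne_zero _ hq))) (hbc _)) (hbcW _)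

/-- Replacing `W` by `W / q ^ N` changes the theta factor of index `m` by a quotient of neighbouring
shifted factorials of length `N`, repeated `m` times, and these telescope in `m`. Each of the
`n(n-1)/2` pairs gives two powers of `q ^ N`: one from the monomial, one from inverting the theta
argument. -/
lemma ellDetConst_div_pow_mul (hp : ‖p‖ < 1) (hq : q ≠ 0) {W b c : ℂ} (hW : W ≠ 0) (hb : b ≠ 0)
    (hc : c ≠ 0) (n N : ℕ) :
    ellDetConst q p (W / q ^ N) b c n * ellPoch q p ((b * c * W)⁻¹ * q ^ (2 - n : ℤ)) N ^ n *
        (q ^ N) ^ (n * (n - 1)) =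
      ellDetConst q p W b c n *
        ∏ i ∈ Finset.range n, ellPoch q p ((b * c * W)⁻¹ * q ^ (1 - i : ℤ)) N := by
  have hN : q ^ N ≠ 0 := pow_ne_zero _ hq
  have hX : b * c * W ≠ 0 := mul_ne_zero (mul_ne_zero hb hc) hW
  have hflip : ∀ z : ℤ, ellE p (b * c * W * q ^ z) =
      -(b * c * W * q ^ z) * ellE p ((b * c * W)⁻¹ * q ^ (-z)) := by
    intro z
    have h0 : (b * c * W)⁻¹ * q ^ (-z) ≠ 0 := mul_ne_zero (inv_ne_zero hX) (zpow_ne_zero _ hq)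
    rw [show b * c * W * q ^ z = ((b * c * W)⁻¹ * q ^ (-z))⁻¹ by
      rw [mul_inv, inv_inv, zpow_neg, inv_inv], ellE_inv hp h0]
  induction n with
  | zero => simp [ellDetConst]
  | succ n ih =>
    have h1 : ellDetConst q p (W / q ^ N) b c (n + 1) *
        (ellPoch q p ((b * c * W)⁻¹ * q ^ (1 - n : ℤ)) N ^ n * (q ^ N) ^ (2 * n)) =
        ellDetConst q p (W / q ^ N) b c n *
          (∏ j ∈ Finset.range n, (-(c * W * q ^ (n - 1 - j)) *
            ellE p (b / c * q ^ (2 * j + 1 - n : ℤ)) * ellE p (b * c * W * q ^ (n - 1 : ℤ)))) *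
          ellPoch q p ((b * c * W)⁻¹ * q ^ (2 - n : ℤ)) N ^ n := by
      have hpw : ∀ t : ℂ, t ^ n = ∏ _j ∈ Finset.range n, t := by simp
      suffices h : (∏ j ∈ Finset.range n, (-(c * (W / q ^ N) * q ^ (n - 1 - j)) *
            ellE p (b / c * q ^ (2 * j + 1 - n : ℤ)) *
            ellE p (b * c * (W / q ^ N) * q ^ (n - 1 : ℤ)))) *
          (ellPoch q p ((b * c * W)⁻¹ * q ^ (1 - n : ℤ)) N * (q ^ N) ^ 2) ^ n =
          (∏ j ∈ Finset.range n, (-(c * W * q ^ (n - 1 - j)) *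
            ellE p (b / c * q ^ (2 * j + 1 - n : ℤ)) * ellE p (b * c * W * q ^ (n - 1 : ℤ)))) *
          ellPoch q p ((b * c * W)⁻¹ * q ^ (2 - n : ℤ)) N ^ n by
        rw [ellDetConst, Finset.prod_range_succ, ← ellDetConst, pow_mul, ← mul_pow]
        linear_combination ellDetConst q p (W / q ^ N) b c n * h
      rw [hpw, hpw, ← Finset.prod_mul_distrib, ← Finset.prod_mul_distrib]
      refine Finset.prod_congr rfl fun j _ => ?_
      have hs := ellPoch_zpow_shift (p := p) hq (b * c * W)⁻¹ (1 - n) N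
      rw [show (1 - n : ℤ) + 1 = 2 - n by ring] at hs
      have f1 := hflip (n - 1)
      have f2 := hflip (n - 1 - N)
      have e1 : b * c * (W / q ^ N) * q ^ (n - 1 : ℤ) = b * c * W * q ^ (n - 1 - N : ℤ) := by
        rw [zpow_sub₀ hq _ (N : ℤ), zpow_natCast]; field_simp
      rw [show -((n : ℤ) - 1) = 1 - n by ring] at f1
      rw [show -((n : ℤ) - 1 - N) = 1 - n + N by ring] at f2
      have e2 : q ^ (n - 1 - N : ℤ) * q ^ N = q ^ (n - 1 : ℤ) := by
        rw [← zpow_natCast, ← zpow_add₀ hq]; congr 1; ring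
      rw [e1, f1, f2]
      have e3 : -(c * (W / q ^ N) * q ^ (n - 1 - j)) * q ^ N = -(c * W * q ^ (n - 1 - j)) := by
        field_simp
      rw [← e3, ← e2]
      linear_combination ((c * (W / q ^ N) * q ^ (n - 1 - j)) * (q ^ N) ^ 2 *
        ellE p (b / c * q ^ (2 * j + 1 - n : ℤ)) * (b * c * W * q ^ (n - 1 - N : ℤ))) * (-hs)
    have h2 : ellDetConst q p W b c (n + 1) = ellDetConst q p W b c n *
        ∏ j ∈ Finset.range n, (-(c * W * q ^ (n - 1 - j)) *
            ellE p (b / c * q ^ (2 * j + 1 - n : ℤ)) * ellE p (b * c * W * q ^ (n - 1 : ℤ))) := by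
      rw [ellDetConst, Finset.prod_range_succ, ← ellDetConst]
    have h3 : (q ^ N) ^ ((n + 1) * (n + 1 - 1)) = (q ^ N) ^ (2 * n) * (q ^ N) ^ (n * (n - 1)) := by
      rw [← pow_add]
      congr 1
      rcases n with _ | n
      · rfl
      · simp only [Nat.add_sub_cancel]; ring
    rw [h3, h2, Finset.prod_range_succ, pow_succ (ellPoch _ _ _ _),
      show (2 - ((n + 1 : ℕ) : ℤ)) = 1 - n by push_cast; ring]
    linear_combination ellPoch q p ((b * c * W)⁻¹ * q ^ (1 - n : ℤ)) N *
      (q ^ N) ^ (n * (n - 1)) * h1 + (∏ j ∈ Finset.range n, (-(c * W * q ^ (n - 1 - j)) *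
            ellE p (b / c * q ^ (2 * j + 1 - n : ℤ)) * ellE p (b * c * W * q ^ (n - 1 : ℤ)))) *
      ellPoch q p ((b * c * W)⁻¹ * q ^ (1 - n : ℤ)) N * ih

end Determinant

/-! ### The sum over one index -/

section SingleSum

variable {p q : ℂ}

lemma ellPoch_mul_ellPoch_comm (x : ℂ) (k j : ℕ) :
    ellPoch q p x k * ellPoch q p (x * q ^ k) j = ellPoch q p x j * ellPoch q p (x * q ^ j) k := by
  rw [← ellPoch_add, ← ellPoch_add, add_comm]

lemma ellPoch_div_pow_mul (hp : ‖p‖ < 1) (hq : q ≠ 0) {y : ℂ} (hy : y ≠ 0) (j k : ℕ) :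
    ellPoch q p (y / q ^ k) j * ellPoch q p (q / y / q ^ j) k * (q ^ j) ^ k =
      ellPoch q p y j * ellPoch q p (q / y) k := by
  have hk : q ^ k ≠ 0 := pow_ne_zero _ hq
  have hj : q ^ j ≠ 0 := pow_ne_zero _ hq
  have h1 := ellPoch_mul_ellPoch_comm (p := p) (q := q) (y / q ^ k) k j
  rw [div_mul_cancel₀ _ hk, ellPoch_div_pow hp hq hy,
    show y / q ^ k * q ^ j = (y * q ^ j) / q ^ k by ring,
    ellPoch_div_pow hp hq (mul_ne_zero hy hj), ← neg_mul, mul_pow, ← div_div] at h1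
  have h2 : (-y) ^ k * invTriPow q k ≠ 0 :=
    mul_ne_zero (pow_ne_zero _ (neg_ne_zero.2 hy)) (invTriPow_ne_zero hq k)
  apply mul_left_cancel₀ h2
  linear_combination -h1

/-- The weight of the index `k` in the sum over one of the variables. -/
noncomputable def jacksonWeight (q p a b c d e : ℂ) (n N : ℕ) (x : ℂ) (k : ℕ) : ℂ :=
  ellE p (a * x ^ 2 * q ^ (2 * k)) / ellE p (a * x ^ 2) *
    (ellPochs q p [a * x ^ 2, b * x, c * x, d * x, e * x, q ^ (-(N : ℤ))] k * q ^ (n * k) /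
      ellPochs q p [q, a * q * x / b, a * q * x / c, a * q * x / d, a * q * x / e,
        a * x ^ 2 * q ^ (N + 1)] k)

lemma ellPoch_wellPoised_shift (hp : ‖p‖ < 1) (hq : q ≠ 0) {a x t : ℂ} (ha : a ≠ 0) (hx : x ≠ 0)
    (ht : t ≠ 0) (i k : ℕ) : ellPoch q p (t * ((a * x)⁻¹ / q ^ k)) i *
      ellPoch q p (a * x ^ 2 * q / (t * x * q ^ i)) k * (q ^ i) ^ k =
      ellPoch q p (t * (a * x)⁻¹) i * ellPoch q p (a * q * x / t) k := by
  have hi : q ^ i ≠ 0 := pow_ne_zero _ hq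
  have := ellPoch_div_pow_mul hp hq (mul_ne_zero ht (inv_ne_zero (mul_ne_zero ha hx))) i k
  rwa [show t * (a * x)⁻¹ / q ^ k = t * ((a * x)⁻¹ / q ^ k) by ring,
    show q / (t * (a * x)⁻¹) / q ^ i = a * x ^ 2 * q / (t * x * q ^ i) by field_simp,
    show q / (t * (a * x)⁻¹) = a * q * x / t by field_simp] at this

/-- Multiplying the weight by a matrix entry only replaces `b` by `b q^j` and `c` by `c q^l`, since
`(x)_k (x q^k)_j = (x)_j (x q^j)_k`. The well-poised denominators release `q^(-(j+l)k)`, which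
lowers `q^((j+l+1)k)` to the `q^k` of the Frenkel-Turaev sum. -/
lemma jacksonWeight_mul (hp : ‖p‖ < 1) (hq : q ≠ 0) {a b c d e x : ℂ} (ha : a ≠ 0)
    (hb : b ≠ 0) (hc : c ≠ 0) (hd : d ≠ 0) (he : e ≠ 0) (hx : x ≠ 0) {j l N k : ℕ}
    (n1 : ellPoch q p (a * q * x / b) k ≠ 0) (n2 : ellPoch q p (a * q * x / c) k ≠ 0)
    (n3 : ellPoch q p (a * q * x / d) k ≠ 0) (n4 : ellPoch q p (a * q * x / e) k ≠ 0)
    (n5 : ellPoch q p (a * x ^ 2 * q / (b * x * q ^ j)) k ≠ 0)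
    (n6 : ellPoch q p (a * x ^ 2 * q / (c * x * q ^ l)) k ≠ 0) (n7 : ellPoch q p q k ≠ 0)
    (n8 : ellPoch q p (a * x ^ 2 * q ^ (N + 1)) k ≠ 0) (n9 : ellE p (a * x ^ 2) ≠ 0) :
    jacksonWeight q p a b c d e (j + l + 1) N x k *
        (ellPoch q p (b * (x * q ^ k)) j * ellPoch q p (b * ((a * x)⁻¹ / q ^ k)) j *
          (ellPoch q p (c * (x * q ^ k)) l * ellPoch q p (c * ((a * x)⁻¹ / q ^ k)) l)) =
      (ellPoch q p (b * x) j * ellPoch q p (b * (a * x)⁻¹) j *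
        (ellPoch q p (c * x) l * ellPoch q p (c * (a * x)⁻¹) l)) *
      (ellE p (a * x ^ 2 * q ^ (2 * k)) / ellE p (a * x ^ 2) *
          (ellPoch q p (a * x ^ 2) k * ellPoch q p (b * x * q ^ j) k *
              ellPoch q p (c * x * q ^ l) k * ellPoch q p (d * x) k * ellPoch q p (e * x) k *
              ellPoch q p (q ^ (-(N : ℤ))) k * q ^ k /
            (ellPoch q p q k * ellPoch q p (a * x ^ 2 * q / (b * x * q ^ j)) k *
              ellPoch q p (a * x ^ 2 * q / (c * x * q ^ l)) k *
              ellPoch q p (a * x ^ 2 * q / (d * x)) k * ellPoch q p (a * x ^ 2 * q / (e * x)) k *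
              ellPoch q p (a * x ^ 2 * q ^ (N + 1)) k))) := by
  have s1 := ellPoch_mul_ellPoch_comm (p := p) (q := q) (b * x) k j
  have s2 := ellPoch_mul_ellPoch_comm (p := p) (q := q) (c * x) k l
  have t1 := ellPoch_wellPoised_shift (p := p) hp hq ha hx hb j k
  have t2 := ellPoch_wellPoised_shift (p := p) hp hq ha hx hc l k
  have hpow : q ^ ((j + l + 1) * k) = (q ^ j) ^ k * (q ^ l) ^ k * q ^ k := by
    rw [add_mul, add_mul, one_mul, pow_add, pow_add, pow_mul, pow_mul]
  rw [show a * x ^ 2 * q / (d * x) = a * q * x / d by field_simp,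
    show a * x ^ 2 * q / (e * x) = a * q * x / e by field_simp,
    show b * (x * q ^ k) = b * x * q ^ k by ring, show c * (x * q ^ k) = c * x * q ^ k by ring]
  simp only [jacksonWeight, ellPochs, List.map_cons, List.map_nil, List.prod_cons, List.prod_nil,
    hpow]
  clear hpow
  generalize ellPoch q p (a * q * x / b) k = X1 at *
  generalize ellPoch q p (a * q * x / c) k = X2 at *
  generalize ellPoch q p (a * q * x / d) k = X3 at *
  generalize ellPoch q p (a * q * x / e) k = X4 at *
  generalize ellPoch q p (a * x ^ 2 * q / (b * x * q ^ j)) k = X5 at *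
  generalize ellPoch q p (a * x ^ 2 * q / (c * x * q ^ l)) k = X6 at *
  generalize ellPoch q p q k = X7 at *
  generalize ellPoch q p (a * x ^ 2 * q ^ (N + 1)) k = X8 at *
  generalize ellE p (a * x ^ 2 * q ^ (2 * k)) = X9 at *
  generalize ellE p (a * x ^ 2) = Y1 at *
  generalize ellPoch q p (b * ((a * x)⁻¹ / q ^ k)) j = Y2 at *
  generalize ellPoch q p (c * ((a * x)⁻¹ / q ^ k)) l = Y3 at *
  generalize ellPoch q p (b * (a * x)⁻¹) j = Y4 at *
  generalize ellPoch q p (c * (a * x)⁻¹) l = Y5 at *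
  generalize ellPoch q p (b * x * q ^ k) j = Y6 at *
  generalize ellPoch q p (c * x * q ^ k) l = Y7 at *
  generalize ellPoch q p (b * x * q ^ j) k = Y8 at *
  generalize ellPoch q p (c * x * q ^ l) k = Y9 at *
  generalize ellPoch q p (b * x) j = Z1 at *
  generalize ellPoch q p (c * x) l = Z2 at *
  generalize ellPoch q p (b * x) k = Z3 at *
  generalize ellPoch q p (c * x) k = Z4 at *
  generalize ellPoch q p (d * x) k = Z5 at *
  generalize ellPoch q p (e * x) k = Z6 at *
  generalize ellPoch q p (q ^ (-(N : ℤ))) k = Z7 at *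
  generalize ellPoch q p (a * x ^ 2) k = Z8 at *
  generalize (q ^ j) ^ k = J at *
  generalize (q ^ l) ^ k = L at *
  generalize q ^ k = K at *
  have e1 : (Z3 * Y6) * (Y2 * X5 * J) * ((Z4 * Y7) * (Y3 * X6 * L)) =
      (Z1 * Y8) * (Y4 * X1) * ((Z2 * Y9) * (Y5 * X2)) := by rw [s1, s2, t1, t2]
  field_simp
  linear_combination (Z5 * Z6 * Z7 * Z8 * K * X9) * e1

/-- The Frenkel-Turaev formula with `A = a x²`, `β = b x q^j`, `γ = c x q^l`, `δ = d x`, `ε = e x`.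
Balancing involves only `j + l`, so one condition serves a whole row of the matrix. The value is
arranged as a factor in `x` and `j + l`, a factor in `j` and `l`, and a matrix entry at `k = N` in
its second argument. -/
lemma sum_jacksonWeight_mul (hp : ‖p‖ < 1) (hq : q ≠ 0) {a b c d e x : ℂ} (ha : a ≠ 0)
    (hb : b ≠ 0) (hc : c ≠ 0) (hd : d ≠ 0) (he : e ≠ 0) (hx : x ≠ 0) {j l N : ℕ}
    (hbal : a ^ 2 * q ^ (N + 1) = b * c * d * e * q ^ (j + l))
    (hqN : ellPoch q p q N ≠ 0)
    (hA : ∀ z : ℤ, ellE p (a * x ^ 2 * q ^ z) ≠ 0) (hex : ∀ z : ℤ, ellE p (e * x * q ^ z) ≠ 0)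
    (hab : ∀ z : ℤ, ellE p (a * x / b * q ^ z) ≠ 0) (hac : ∀ z : ℤ, ellE p (a * x / c * q ^ z) ≠ 0)
    (had : ∀ z : ℤ, ellE p (a * x / d * q ^ z) ≠ 0) (hae : ∀ z : ℤ, ellE p (a * x / e * q ^ z) ≠ 0)
    (hbc : ∀ z : ℤ, ellE p (b * c * a⁻¹ * q ^ z) ≠ 0) :
    ∑ k ∈ Finset.range (N + 1), jacksonWeight q p a b c d e (j + l + 1) N x k *
        (ellPoch q p (b * (x * q ^ k)) j * ellPoch q p (b * ((a * x)⁻¹ / q ^ k)) j *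
          (ellPoch q p (c * (x * q ^ k)) l * ellPoch q p (c * ((a * x)⁻¹ / q ^ k)) l)) =
      ellPoch q p (a * q * x ^ 2) N *
          (ellPoch q p ((b * c * a⁻¹)⁻¹ * q ^ (1 - j - l : ℤ)) N * (q ^ N) ^ (j + l)) /
          (ellPoch q p (a * q ^ (1 - j - l : ℤ) / (b * c * d * x)) N *
            (ellPoch q p (a * q * x / b) N *
            (ellPoch q p (a * q * x / c) N * ellPoch q p (a * q * x / d) N))) *
        (ellPoch q p (a * q ^ (1 - j : ℤ) / (b * d)) N *
          ellPoch q p (a * q ^ (1 - l : ℤ) / (c * d)) N *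
        (ellPoch q p (b * x) j * ellPoch q p (b * ((a * x)⁻¹ / q ^ N)) j *
          (ellPoch q p (c * x) l * ellPoch q p (c * ((a * x)⁻¹ / q ^ N)) l))) := by
  have hj : q ^ j ≠ 0 := pow_ne_zero _ hq
  have hl : q ^ l ≠ 0 := pow_ne_zero _ hq
  have hFT := frenkelTuraev (A := a * x ^ 2) (β := b * x * q ^ j) (γ := c * x * q ^ l)
    (δ := d * x) (ε := e * x) (N := N) hp hq (mul_ne_zero ha (pow_ne_zero _ hx))
    (mul_ne_zero (mul_ne_zero hb hx) hj) (mul_ne_zero (mul_ne_zero hc hx) hl)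
    (mul_ne_zero hd hx) (mul_ne_zero he hx)
    (by rw [pow_add q j l] at hbal; linear_combination x ^ 4 * hbal) hqN hA hex
    (fun z => by
      rw [show a * x ^ 2 / (b * x * q ^ j) * q ^ z = a * x / b * q ^ (z - j) by
        rw [zpow_sub₀ hq, zpow_natCast]; field_simp]
      exact hab _)
    (fun z => by
      rw [show a * x ^ 2 / (c * x * q ^ l) * q ^ z = a * x / c * q ^ (z - l) by
        rw [zpow_sub₀ hq, zpow_natCast]; field_simp]
      exact hac _)
    (fun z => by
      rw [show a * x ^ 2 / (d * x) * q ^ z = a * x / d * q ^ z by field_simp]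
      exact had _)
    (fun z => by
      rw [show a * x ^ 2 / (e * x) * q ^ z = a * x / e * q ^ z by field_simp]
      exact hae _)
    (fun z => by
      rw [show b * x * q ^ j * (c * x * q ^ l) / (a * x ^ 2) * q ^ z =
          b * c * a⁻¹ * q ^ (j + l + z) by
        rw [zpow_add₀ hq, zpow_add₀ hq, zpow_natCast, zpow_natCast]; field_simp]
      exact hbc _)
  have hshift : ∀ (t : ℂ), (∀ z : ℤ, ellE p (a * x / t * q ^ z) ≠ 0) → ∀ k,
      ellPoch q p (a * q * x / t) k ≠ 0 := by
    intro t ht k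
    have := ellPoch_zpow_ne_zero hq ht 1 k
    rwa [zpow_one, show a * x / t * q = a * q * x / t by ring] at this
  have hshift' : ∀ (t : ℂ) (i : ℕ), t ≠ 0 → (∀ z : ℤ, ellE p (a * x / t * q ^ z) ≠ 0) → ∀ k,
      ellPoch q p (a * x ^ 2 * q / (t * x * q ^ i)) k ≠ 0 := by
    intro t i ht0 ht k
    have := ellPoch_zpow_ne_zero hq ht (1 - i) k
    rwa [show a * x / t * q ^ (1 - i : ℤ) = a * x ^ 2 * q / (t * x * q ^ i) by
      rw [zpow_sub₀ hq, zpow_one, zpow_natCast]; field_simp] at this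
  have hterm := fun k (hk : k ∈ Finset.range (N + 1)) =>
    jacksonWeight_mul hp hq ha hb hc hd he hx (j := j) (l := l) (N := N)
      (hshift b hab k) (hshift c hac k) (hshift d had k) (hshift e hae k) (hshift' b j hb hab k)
      (hshift' c l hc hac k) (ellPoch_ne_zero_of_le hqN (Nat.lt_succ_iff.1 (Finset.mem_range.1 hk)))
      (by rw [← zpow_natCast q (N + 1)]; exact ellPoch_zpow_ne_zero hq hA _ _) (by simpa using hA 0)
  refine ((Finset.sum_congr rfl hterm).trans (Finset.mul_sum _ _ _).symm).trans ?_
  rw [hFT]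
  have t1 := ellPoch_wellPoised_shift (p := p) hp hq ha hx hb j N
  have t2 := ellPoch_wellPoised_shift (p := p) hp hq ha hx hc l N
  have n1 := hshift b hab N
  have n2 := hshift c hac N
  have n3 := hshift d had N
  have n5 := hshift' b j hb hab N
  have n6 := hshift' c l hc hac N
  have hjl : q ^ (1 - j - l : ℤ) = q / (q ^ j * q ^ l) := by
    rw [zpow_sub₀ hq, zpow_sub₀ hq, zpow_one, zpow_natCast, zpow_natCast, div_div]
  have hj1 : q ^ (1 - j : ℤ) = q / q ^ j := by rw [zpow_sub₀ hq, zpow_one, zpow_natCast]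
  have hl1 : q ^ (1 - l : ℤ) = q / q ^ l := by rw [zpow_sub₀ hq, zpow_one, zpow_natCast]
  rw [show a * x ^ 2 * q / (d * x) = a * q * x / d by field_simp,
    show a * x ^ 2 * q = a * q * x ^ 2 by ring, hjl, hj1, hl1,
    show a * q * x ^ 2 / (b * x * q ^ j * (c * x * q ^ l)) =
      (b * c * a⁻¹)⁻¹ * (q / (q ^ j * q ^ l)) by field_simp,
    show a * q * x ^ 2 / (b * x * q ^ j * (d * x)) = a * (q / q ^ j) / (b * d) by field_simp,
    show a * q * x ^ 2 / (c * x * q ^ l * (d * x)) = a * (q / q ^ l) / (c * d) by field_simp,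
    show a * q * x ^ 2 / (b * x * q ^ j * (c * x * q ^ l) * (d * x)) =
      a * (q / (q ^ j * q ^ l)) / (b * c * d * x) by field_simp]
  rw [show a * x ^ 2 * q = a * q * x ^ 2 by ring] at n5 n6 t1 t2
  have hpow : (q ^ N) ^ (j + l) = (q ^ j) ^ N * (q ^ l) ^ N := by
    rw [pow_add, ← pow_mul, ← pow_mul, ← pow_mul, ← pow_mul, mul_comm N, mul_comm N]
  rw [hpow]
  clear hFT hshift hshift' hA hex hab hac had hae hbc hpow hterm
  generalize ellPoch q p (a * q * x / b) N = X1 at *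
  generalize ellPoch q p (a * q * x / c) N = X2 at *
  generalize ellPoch q p (a * q * x / d) N = X3 at *
  generalize ellPoch q p (a * q * x ^ 2 / (b * x * q ^ j)) N = X5 at *
  generalize ellPoch q p (a * q * x ^ 2 / (c * x * q ^ l)) N = X6 at *
  generalize ellPoch q p (b * ((a * x)⁻¹ / q ^ N)) j = Y2 at *
  generalize ellPoch q p (c * ((a * x)⁻¹ / q ^ N)) l = Y3 at *
  generalize ellPoch q p (b * (a * x)⁻¹) j = Y4 at *
  generalize ellPoch q p (c * (a * x)⁻¹) l = Y5 at *
  generalize ellPoch q p (b * x) j = Z1 at *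
  generalize ellPoch q p (c * x) l = Z2 at *
  generalize (q ^ j) ^ N = J at *
  generalize (q ^ l) ^ N = L at *
  generalize ellPoch q p (a * q * x ^ 2) N = U1 at *
  generalize ellPoch q p ((b * c * a⁻¹)⁻¹ * (q / (q ^ j * q ^ l))) N = U2 at *
  generalize ellPoch q p (a * (q / q ^ j) / (b * d)) N = U3 at *
  generalize ellPoch q p (a * (q / q ^ l) / (c * d)) N = U4 at *
  generalize ellPoch q p (a * (q / (q ^ j * q ^ l)) / (b * c * d * x)) N = U5 at *
  have f1 : Y4 = Y2 * X5 * J / X1 := by rw [t1]; field_simp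
  have f2 : Y5 = Y3 * X6 * L / X2 := by rw [t2]; field_simp
  rw [f1, f2]
  -- `U5` is a denominator on both sides, so if it is zero both sides are zero by the convention for
  -- division.
  by_cases h5 : U5 = 0
  · simp [h5]
  · field_simp

end SingleSum

/-! ### The multiple sum for generic parameters -/

section Generic

variable {p q : ℂ}

/-- The left-hand side of the multivariable summation formula. -/
noncomputable def ellJacksonSum (n N : ℕ) (p q a b c d e : ℂ) (x : Fin n → ℂ) : ℂ :=
  ∑ k ∈ Fintype.piFinset (fun _ : Fin n => Finset.range (N + 1)),
    (∏ i : Fin n, ∏ j ∈ Finset.Ioi i,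
      (ellE p (q ^ ((k i : ℤ) - (k j : ℤ)) * x i / x j) / ellE p (x i / x j) *
        (ellE p (a * x i * x j * q ^ (k i + k j)) / ellE p (a * x i * x j * q ^ N)))) *
    ∏ i : Fin n,
      (ellE p (a * x i ^ 2 * q ^ (2 * k i)) / ellE p (a * x i ^ 2) *
        (ellPochs q p [a * x i ^ 2, b * x i, c * x i, d * x i, e * x i, q ^ (-(N : ℤ))] (k i) *
            q ^ (((i : ℕ) + 1) * k i) /
          ellPochs q p [q, a * q * x i / b, a * q * x i / c, a * q * x i / d,
            a * q * x i / e, a * x i ^ 2 * q ^ (N + 1)] (k i)))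

/-- The right-hand side of the multivariable summation formula. -/
noncomputable def ellJacksonProd (n N : ℕ) (p q a b c d : ℂ) (x : Fin n → ℂ) : ℂ :=
  ∏ i : Fin n,
    (ellPochs q p [a * q * x i ^ 2,
        a * q ^ (2 - (((i : ℕ) : ℤ) + 1)) / (b * c),
        a * q ^ (2 - (((i : ℕ) : ℤ) + 1)) / (b * d),
        a * q ^ (2 - (((i : ℕ) : ℤ) + 1)) / (c * d)] N /
      ellPochs q p [a * q ^ (2 - (n : ℤ)) / (b * c * d * x i),
        a * q * x i / b, a * q * x i / c, a * q * x i / d] N)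

/-- The parameters avoid the zeros of all theta functions that occur in the determinantal proof of
the summation formula. -/
structure JacksonGeneric (p q a b c d e : ℂ) {n : ℕ} (x : Fin n → ℂ) : Prop where
  sq : ∀ i, ∀ z : ℤ, ellE p (a * x i ^ 2 * q ^ z) ≠ 0
  mul_c : ∀ i, ∀ z : ℤ, ellE p (c * x i * q ^ z) ≠ 0
  mul_e : ∀ i, ∀ z : ℤ, ellE p (e * x i * q ^ z) ≠ 0
  div_b : ∀ i, ∀ z : ℤ, ellE p (a * x i / b * q ^ z) ≠ 0
  div_c : ∀ i, ∀ z : ℤ, ellE p (a * x i / c * q ^ z) ≠ 0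
  div_d : ∀ i, ∀ z : ℤ, ellE p (a * x i / d * q ^ z) ≠ 0
  div_e : ∀ i, ∀ z : ℤ, ellE p (a * x i / e * q ^ z) ≠ 0
  b_mul_c : ∀ z : ℤ, ellE p (b * c * a⁻¹ * q ^ z) ≠ 0
  b_div_c : ∀ z : ℤ, ellE p (b / c * q ^ z) ≠ 0

lemma sum_piFinset_det_eq_det_sum {n : ℕ} (s : Finset ℕ) (f : Fin n → ℕ → Fin n → ℂ) :
    ∑ k ∈ Fintype.piFinset (fun _ : Fin n => s), (Matrix.of fun i j => f i (k i) j).det =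
      (Matrix.of fun i j => ∑ m ∈ s, f i m j).det := by
  have h := (Matrix.detRowAlternating (R := ℂ) (n := Fin n)).toMultilinearMap.map_sum_finset
    (fun i m => f i m) (fun _ => s)
  have h1 : (fun i => ∑ m ∈ s, f i m) = fun i j => ∑ m ∈ s, f i m j := by
    funext i j
    rw [Finset.sum_apply]
  rw [h1] at h
  exact h.symm

/-- Stated with both `k` and `M` because it is used twice: with `M = 0` for the summand, and with `k
= 0`, `M = N` for the matrix that results from the summation. -/
lemma ellMatrix_det_of_generic (hp : ‖p‖ < 1) (hq : q ≠ 0) {a b c d e : ℂ} {n : ℕ} {x : Fin n → ℂ}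
    (ha : a ≠ 0) (hb : b ≠ 0) (hc : c ≠ 0) (hx : ∀ i, x i ≠ 0)
    (hg : JacksonGeneric p q a b c d e x) (k : Fin n → ℕ) (M : ℕ) (W : ℂ)
    (hW : ∀ i, x i * q ^ k i * ((a * x i)⁻¹ / q ^ (M + k i)) = W) :
    (ellMatrix q p b c (fun i => x i * q ^ k i) (fun i => (a * x i)⁻¹ / q ^ (M + k i))).det =
      ellDetConst q p W b c n * (∏ i, (x i * q ^ k i)⁻¹ ^ (n - 1 - i : ℕ)) *
      ∏ i, ∏ j ∈ Finset.Ioi i, (ellE p (q ^ ((k i : ℤ) - (k j : ℤ)) * x i / x j) *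
        ellE p (a * x i * x j * q ^ (M + k i + k j))) := by
  have hk : ∀ m : ℕ, q ^ m ≠ 0 := fun m => pow_ne_zero _ hq
  have hax : ∀ i, a * x i ≠ 0 := fun i => mul_ne_zero ha (hx i)
  rw [det_ellMatrix hp hq hb hc (W := W) _ _ (fun i => mul_ne_zero (hx i) (hk _))
    (fun i => div_ne_zero (inv_ne_zero (hax i)) (hk _)) hW]
  · congr 1
    refine Finset.prod_congr rfl fun i _ => Finset.prod_congr rfl fun j _ => ?_
    have h1 := hx i
    have h2 := hx j
    have h3 := hk (k i)
    have h4 := hk (k j)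
    have h5 := hk M
    congr 2
    · rw [zpow_sub₀ hq, zpow_natCast, zpow_natCast]; field_simp
    · rw [pow_add, pow_add, pow_add]; field_simp
  · intro i z
    rw [show c * (x i * q ^ k i) * q ^ z = c * x i * q ^ (k i + z) by
      rw [zpow_add₀ hq, zpow_natCast]; ring]
    exact hg.mul_c i _
  · intro i z
    have h := ellE_inv_mul_zpow_ne_zero hp hq (div_ne_zero (hax i) hc) (hg.div_c i)
      (z - (M + k i : ℕ))
    rw [zpow_sub₀ hq, zpow_natCast] at h
    have h1 := hx i
    have h2 := hk (M + k i)
    rwa [show c * ((a * x i)⁻¹ / q ^ (M + k i)) * q ^ z =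
      (a * x i / c)⁻¹ * (q ^ z / q ^ (M + k i)) by field_simp]

lemma ellJacksonSum_eq_det (hp : ‖p‖ < 1) (hq : q ≠ 0) {a b c d e : ℂ} {n : ℕ} {x : Fin n → ℂ}
    (ha : a ≠ 0) (hb : b ≠ 0) (hc : c ≠ 0) (hx : ∀ i, x i ≠ 0)
    (hg : JacksonGeneric p q a b c d e x) (N : ℕ) :
    ellJacksonSum n N p q a b c d e x = (∏ i, x i ^ (n - 1 - i : ℕ)) /
        (ellDetConst q p a⁻¹ b c n * ∏ i, ∏ j ∈ Finset.Ioi i,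
          (ellE p (x i / x j) * ellE p (a * x i * x j * q ^ N))) *
      (Matrix.of fun i j : Fin n => ∑ k ∈ Finset.range (N + 1),
        jacksonWeight q p a b c d e n N (x i) k *
        (ellPoch q p (b * (x i * q ^ k)) j * ellPoch q p (b * ((a * x i)⁻¹ / q ^ k)) j *
          (ellPoch q p (c * (x i * q ^ k)) (n - 1 - j) *
            ellPoch q p (c * ((a * x i)⁻¹ / q ^ k)) (n - 1 - j)))).det := by
  have hk : ∀ m : ℕ, q ^ m ≠ 0 := fun m => pow_ne_zero _ hq
  have hC := ellDetConst_ne_zero hq (inv_ne_zero ha) hc hg.b_div_c hg.b_mul_c n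
  rw [← sum_piFinset_det_eq_det_sum _ (fun (i : Fin n) k (j : Fin n) =>
    jacksonWeight q p a b c d e n N (x i) k *
        (ellPoch q p (b * (x i * q ^ k)) j * ellPoch q p (b * ((a * x i)⁻¹ / q ^ k)) j *
          (ellPoch q p (c * (x i * q ^ k)) (n - 1 - j) *
            ellPoch q p (c * ((a * x i)⁻¹ / q ^ k)) (n - 1 - j)))), ellJacksonSum, Finset.mul_sum]
  refine Finset.sum_congr rfl fun k _ => ?_
  have hdet := ellMatrix_det_of_generic hp hq ha hb hc hx hg k 0 a⁻¹ (fun i => by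
    have h1 := hx i
    have h2 := hk (k i)
    rw [zero_add]
    field_simp)
  simp only [zero_add] at hdet
  have hrow : (Matrix.of fun i j : Fin n => jacksonWeight q p a b c d e n N (x i) (k i) *
        (ellPoch q p (b * (x i * q ^ k i)) j * ellPoch q p (b * ((a * x i)⁻¹ / q ^ k i)) j *
          (ellPoch q p (c * (x i * q ^ k i)) (n - 1 - j) *
            ellPoch q p (c * ((a * x i)⁻¹ / q ^ k i)) (n - 1 - j)))).det =
      (∏ i, jacksonWeight q p a b c d e n N (x i) (k i)) *
      (ellMatrix q p b c (fun i => x i * q ^ k i) (fun i => (a * x i)⁻¹ / q ^ k i)).det :=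
    Matrix.det_mul_column _ _
  -- The determinant contributes `(x_i q^(k_i))^(-(n-1-i))`. Compensating for it turns the
  -- row-dependent power `q^((i+1) k_i)` into `q^(n k_i)`, the uniform weight needed for the single
  -- sums.
  have hw : ∏ i, jacksonWeight q p a b c d e n N (x i) (k i) =
      (∏ i : Fin n, (ellE p (a * x i ^ 2 * q ^ (2 * k i)) / ellE p (a * x i ^ 2) *
        (ellPochs q p [a * x i ^ 2, b * x i, c * x i, d * x i, e * x i, q ^ (-(N : ℤ))] (k i) *
            q ^ (((i : ℕ) + 1) * k i) /
          ellPochs q p [q, a * q * x i / b, a * q * x i / c, a * q * x i / d,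
            a * q * x i / e, a * x i ^ 2 * q ^ (N + 1)] (k i)))) *
        ∏ i : Fin n, (q ^ k i) ^ (n - 1 - i : ℕ) := by
    rw [← Finset.prod_mul_distrib]
    refine Finset.prod_congr rfl fun i _ => ?_
    have hn : n * k i = ((i : ℕ) + 1) * k i + k i * (n - 1 - i) := by
      have hi := i.2
      rw [mul_comm (k i), ← add_mul]
      congr 1
      omega
    rw [jacksonWeight, hn, pow_add, pow_mul q (k i)]
    ring
  have hxk : (∏ i, x i ^ (n - 1 - i : ℕ)) * ((∏ i : Fin n, (q ^ k i) ^ (n - 1 - i : ℕ)) *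
      ∏ i, (x i * q ^ k i)⁻¹ ^ (n - 1 - i : ℕ)) = 1 := by
    rw [← Finset.prod_mul_distrib, ← Finset.prod_mul_distrib]
    refine Finset.prod_eq_one fun i _ => ?_
    rw [← mul_pow, ← mul_pow, ← mul_assoc, mul_inv_cancel₀ (mul_ne_zero (hx i) (hk _)), one_pow]
  have hpair : ∏ i : Fin n, ∏ j ∈ Finset.Ioi i,
      (ellE p (q ^ ((k i : ℤ) - (k j : ℤ)) * x i / x j) / ellE p (x i / x j) *
        (ellE p (a * x i * x j * q ^ (k i + k j)) / ellE p (a * x i * x j * q ^ N))) =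
      (∏ i, ∏ j ∈ Finset.Ioi i, (ellE p (q ^ ((k i : ℤ) - (k j : ℤ)) * x i / x j) *
        ellE p (a * x i * x j * q ^ (k i + k j)))) / ∏ i, ∏ j ∈ Finset.Ioi i,
          (ellE p (x i / x j) * ellE p (a * x i * x j * q ^ N)) := by
    rw [← Finset.prod_div_distrib]
    refine Finset.prod_congr rfl fun i _ => ?_
    rw [← Finset.prod_div_distrib]
    exact Finset.prod_congr rfl fun j _ => div_mul_div_comm _ _ _ _
  rw [hrow, hdet, hw, hpair]
  generalize (∏ i, ∏ j ∈ Finset.Ioi i, (ellE p (q ^ ((k i : ℤ) - (k j : ℤ)) * x i / x j) *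
        ellE p (a * x i * x j * q ^ (k i + k j)))) = P1
  generalize (∏ i, ∏ j ∈ Finset.Ioi i,
          (ellE p (x i / x j) * ellE p (a * x i * x j * q ^ N))) = P2
  generalize (∏ i : Fin n, (ellE p (a * x i ^ 2 * q ^ (2 * k i)) / ellE p (a * x i ^ 2) *
        (ellPochs q p [a * x i ^ 2, b * x i, c * x i, d * x i, e * x i, q ^ (-(N : ℤ))] (k i) *
            q ^ (((i : ℕ) + 1) * k i) /
          ellPochs q p [q, a * q * x i / b, a * q * x i / c, a * q * x i / d,
            a * q * x i / e, a * x i ^ 2 * q ^ (N + 1)] (k i)))) = P3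
  generalize ∏ i, x i ^ (n - 1 - i : ℕ) = X1 at *
  generalize ∏ i : Fin n, (q ^ k i) ^ (n - 1 - i : ℕ) = X2 at *
  generalize ∏ i, (x i * q ^ k i)⁻¹ ^ (n - 1 - i : ℕ) = X3 at *
  generalize ellDetConst q p a⁻¹ b c n = C at *
  -- No pair condition is assumed here; if `P2 = 0`, both sides are zero.
  have e : X1 / (C * P2) * (P3 * X2 * (C * X3 * P1)) = (X1 * (X2 * X3)) * (P1 / P2 * P3) := by
    by_cases hP : P2 = 0
    · simp [hP]
    · field_simp
  rw [e, hxk, one_mul]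

lemma ellJacksonSum_eq_ellJacksonProd_of_generic (hp : ‖p‖ < 1) (hq : q ≠ 0) {a b c d e : ℂ}
    {n N : ℕ} {x : Fin n → ℂ} (ha : a ≠ 0) (hb : b ≠ 0) (hc : c ≠ 0) (hd : d ≠ 0) (he : e ≠ 0)
    (hx : ∀ i, x i ≠ 0) (hbal : a ^ 2 * q ^ ((N : ℤ) - (n : ℤ) + 2) = b * c * d * e)
    (hqN : n ≠ 0 → ellPoch q p q N ≠ 0)
    (hpair : ∀ i j : Fin n, i < j → ellE p (x i / x j) ≠ 0 ∧ ellE p (a * x i * x j * q ^ N) ≠ 0)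
    (hg : JacksonGeneric p q a b c d e x) :
    ellJacksonSum n N p q a b c d e x = ellJacksonProd n N p q a b c d x := by
  have hk : ∀ m : ℕ, q ^ m ≠ 0 := fun m => pow_ne_zero _ hq
  have hC := ellDetConst_ne_zero hq (inv_ne_zero ha) hc hg.b_div_c hg.b_mul_c n
  have hconst := ellDetConst_div_pow_mul hp hq (inv_ne_zero ha) hb hc n N
  let R : Fin n → ℂ := fun i => ellPoch q p (a * q * x i ^ 2) N *
          (ellPoch q p ((b * c * a⁻¹)⁻¹ * q ^ (2 - n : ℤ)) N * (q ^ N) ^ (n - 1)) /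
          (ellPoch q p (a * q ^ (2 - n : ℤ) / (b * c * d * x i)) N *
            (ellPoch q p (a * q * x i / b) N *
            (ellPoch q p (a * q * x i / c) N * ellPoch q p (a * q * x i / d) N)))
  let S : Fin n → ℂ := fun j => ellPoch q p (a * q ^ (1 - j : ℤ) / (b * d)) N *
          ellPoch q p (a * q ^ (1 - (n - 1 - j : ℕ) : ℤ) / (c * d)) N
  have hentry : (Matrix.of fun i j : Fin n => ∑ k ∈ Finset.range (N + 1),
        jacksonWeight q p a b c d e n N (x i) k *
        (ellPoch q p (b * (x i * q ^ k)) j * ellPoch q p (b * ((a * x i)⁻¹ / q ^ k)) j *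
          (ellPoch q p (c * (x i * q ^ k)) (n - 1 - j) *
            ellPoch q p (c * ((a * x i)⁻¹ / q ^ k)) (n - 1 - j)))) =
      Matrix.of fun i j => R i * (Matrix.of (fun i j => S j *
        ellMatrix q p b c x (fun i => (a * x i)⁻¹ / q ^ N) i j)) i j := by
    ext i j
    simp only [Matrix.of_apply]
    have hj := j.2
    obtain ⟨l, hl⟩ : ∃ l, n = j + l + 1 := ⟨n - 1 - j, by omega⟩
    have hbal' : a ^ 2 * q ^ (N + 1) = b * c * d * e * q ^ ((j : ℕ) + l) := by
      rw [← hbal, mul_assoc, ← zpow_natCast q (j + l), ← zpow_add₀ hq,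
        ← zpow_natCast q (N + 1)]
      congr 2
      omega
    have h := sum_jacksonWeight_mul hp hq ha hb hc hd he (hx i) hbal' (hqN (by omega)) (hg.sq i)
      (hg.mul_e i) (hg.div_b i) (hg.div_c i) (hg.div_d i) (hg.div_e i) hg.b_mul_c
    have hz : (1 : ℤ) - (j : ℕ) - l = 2 - n := by omega
    rw [← hl, hz] at h
    simp only [R, S, ellMatrix, Matrix.of_apply, show n - 1 = (j : ℕ) + l by omega,
      Nat.add_sub_cancel_left]
    exact h
  -- The second evaluation: its double product is exactly the pair denominator of the sum.
  have hdet' := ellMatrix_det_of_generic hp hq ha hb hc hx hg (fun _ => 0) N (a⁻¹ / q ^ N)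
    (fun i => by
      have h1 := hx i
      have h2 := hk N
      rw [add_zero, pow_zero]
      field_simp)
  simp only [pow_zero, mul_one, add_zero, Nat.cast_zero, sub_zero, zpow_zero, one_mul] at hdet'
  rw [ellJacksonSum_eq_det hp hq ha hb hc hx hg, hentry, Matrix.det_mul_column,
    Matrix.det_mul_row, hdet']
  have hP : (∏ i, ∏ j ∈ Finset.Ioi i,
      (ellE p (x i / x j) * ellE p (a * x i * x j * q ^ N))) ≠ 0 :=
    Finset.prod_ne_zero_iff.2 fun i _ => Finset.prod_ne_zero_iff.2 fun j hj =>
      mul_ne_zero (hpair i j (Finset.mem_Ioi.1 hj)).1 (hpair i j (Finset.mem_Ioi.1 hj)).2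
  have hxx : (∏ i, x i ^ (n - 1 - i : ℕ)) * ∏ i, (x i)⁻¹ ^ (n - 1 - i : ℕ) = 1 := by
    rw [← Finset.prod_mul_distrib]
    refine Finset.prod_eq_one fun i _ => ?_
    rw [← mul_pow, mul_inv_cancel₀ (hx i), one_pow]
  -- The factors in `c * d` come in reversed column order.
  have hS : ∏ j, S j = (∏ j : Fin n, ellPoch q p (a * q ^ (1 - j : ℤ) / (b * d)) N) *
      ∏ j : Fin n, ellPoch q p (a * q ^ (1 - j : ℤ) / (c * d)) N := by
    rw [Finset.prod_mul_distrib]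
    congr 1
    rw [← Finset.prod_range (fun j : ℕ => ellPoch q p (a * q ^ (1 - j : ℤ) / (c * d)) N),
      ← Finset.prod_range_reflect, Finset.prod_range]
  have hR : ∏ i, R i = (∏ i, ellPoch q p (a * q * x i ^ 2) N /
          (ellPoch q p (a * q ^ (2 - n : ℤ) / (b * c * d * x i)) N *
            (ellPoch q p (a * q * x i / b) N *
            (ellPoch q p (a * q * x i / c) N * ellPoch q p (a * q * x i / d) N)))) *
      (ellPoch q p ((b * c * a⁻¹)⁻¹ * q ^ (2 - n : ℤ)) N ^ n * (q ^ N) ^ (n * (n - 1))) := by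
    have h1 : ellPoch q p ((b * c * a⁻¹)⁻¹ * q ^ (2 - n : ℤ)) N ^ n * (q ^ N) ^ (n * (n - 1)) =
        ∏ _i : Fin n, (ellPoch q p ((b * c * a⁻¹)⁻¹ * q ^ (2 - n : ℤ)) N * (q ^ N) ^ (n - 1)) := by
      rw [Finset.prod_const, Finset.card_univ, Fintype.card_fin, mul_pow, ← pow_mul (q ^ N),
        mul_comm n]
    rw [h1, ← Finset.prod_mul_distrib]
    exact Finset.prod_congr rfl fun i _ => by simp only [R]; ring
  have hrhs : ellJacksonProd n N p q a b c d x = (∏ i, ellPoch q p (a * q * x i ^ 2) N /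
          (ellPoch q p (a * q ^ (2 - n : ℤ) / (b * c * d * x i)) N *
            (ellPoch q p (a * q * x i / b) N *
            (ellPoch q p (a * q * x i / c) N * ellPoch q p (a * q * x i / d) N)))) *
      ((∏ i ∈ Finset.range n, ellPoch q p ((b * c * a⁻¹)⁻¹ * q ^ (1 - i : ℤ)) N) *
      ((∏ j : Fin n, ellPoch q p (a * q ^ (1 - j : ℤ) / (b * d)) N) *
      ∏ j : Fin n, ellPoch q p (a * q ^ (1 - j : ℤ) / (c * d)) N)) := by
    rw [ellJacksonProd, Finset.prod_range, ← Finset.prod_mul_distrib, ← Finset.prod_mul_distrib,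
      ← Finset.prod_mul_distrib]
    refine Finset.prod_congr rfl fun i _ => ?_
    rw [show (2 - (((i : ℕ) : ℤ) + 1)) = 1 - (i : ℕ) by ring,
      show (b * c * a⁻¹)⁻¹ * q ^ (1 - (i : ℕ) : ℤ) = a * q ^ (1 - (i : ℕ) : ℤ) / (b * c) by
        rw [mul_inv, inv_inv]; ring]
    simp only [ellPochs, List.map_cons, List.map_nil, List.prod_cons, List.prod_nil, mul_one]
    ring
  rw [hS, hR, hrhs]
  generalize (∏ i, ∏ j ∈ Finset.Ioi i,
          (ellE p (x i / x j) * ellE p (a * x i * x j * q ^ N))) = P2 at *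
  generalize (∏ i, x i ^ (n - 1 - i : ℕ)) = X1 at *
  generalize (∏ i, (x i)⁻¹ ^ (n - 1 - i : ℕ)) = X2 at *
  generalize (∏ i, ellPoch q p (a * q * x i ^ 2) N /
          (ellPoch q p (a * q ^ (2 - n : ℤ) / (b * c * d * x i)) N *
            (ellPoch q p (a * q * x i / b) N *
            (ellPoch q p (a * q * x i / c) N * ellPoch q p (a * q * x i / d) N)))) = Y1 at *
  generalize (∏ j : Fin n, ellPoch q p (a * q ^ (1 - j : ℤ) / (b * d)) N) *
      ∏ j : Fin n, ellPoch q p (a * q ^ (1 - j : ℤ) / (c * d)) N = Y2 at *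
  generalize ellPoch q p ((b * c * a⁻¹)⁻¹ * q ^ (2 - n : ℤ)) N ^ n = Y3 at *
  generalize (q ^ N) ^ (n * (n - 1)) = Y4 at *
  generalize (∏ i ∈ Finset.range n, ellPoch q p ((b * c * a⁻¹)⁻¹ * q ^ (1 - i : ℤ)) N) = Y5 at *
  generalize ellDetConst q p a⁻¹ b c n = C at *
  generalize ellDetConst q p (a⁻¹ / q ^ N) b c n = C' at *
  field_simp
  linear_combination (Y1 * Y2 * X1 * X2) * hconst + (Y1 * Y2 * C * Y5) * hxx

end Generic

/-! ### Removing genericity by perturbation -/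

section Perturbation

open Filter Topology

instance countableInterFilter_cocountable {α : Type*} :
    CountableInterFilter (cocountable : Filter α) where
  countable_sInter_mem S hS h := by
    rw [mem_cocountable, Set.compl_sInter]
    exact (hS.image _).sUnion (Set.forall_mem_image.2 fun s hs => mem_cocountable.1 (h s hs))

variable {p q : ℂ}

lemma continuousAt_ellPoch (hp : ‖p‖ < 1) (hq : q ≠ 0) {f : ℂ → ℂ} {t : ℂ}
    (hf : ContinuousAt f t) (h0 : f t ≠ 0) (m : ℕ) :
    ContinuousAt (fun s => ellPoch q p (f s) m) t := by
  refine tendsto_finsetProd _ fun k _ => ?_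
  have h1 : f t * q ^ k ≠ 0 := mul_ne_zero h0 (pow_ne_zero _ hq)
  exact (continuousAt_ellE hp h1).comp (f := fun s => f s * q ^ k) (hf.mul continuousAt_const)

lemma continuousAt_ellPochs (hp : ‖p‖ < 1) (hq : q ≠ 0) {t : ℂ} (fs : List (ℂ → ℂ)) (m : ℕ)
    (h : ∀ f ∈ fs, ContinuousAt f t ∧ f t ≠ 0) :
    ContinuousAt (fun s => ellPochs q p (fs.map fun f => f s) m) t := by
  induction fs with
  | nil => simpa [ellPochs] using continuousAt_const
  | cons f fs ih =>
    simp only [List.forall_mem_cons] at h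
    have h1 := (continuousAt_ellPoch hp hq h.1.1 h.1.2 m).mul (ih h.2)
    simp only [ellPochs, List.map_cons, List.prod_cons]
    exact h1

lemma ellPochs_ne_zero_of_le {as : List ℂ} {m n : ℕ} (h : ellPochs q p as n ≠ 0) (hmn : m ≤ n) :
    ellPochs q p as m ≠ 0 := by
  unfold ellPochs at *
  induction as with
  | nil => simp
  | cons a as ih =>
    simp only [List.map_cons, List.prod_cons] at h ⊢
    exact mul_ne_zero (ellPoch_ne_zero_of_le (left_ne_zero_of_mul h) hmn)
      (ih (right_ne_zero_of_mul h))

lemma finite_setOf_mul_zpow_eq {Q w : ℂ} (hQ : Q ≠ 0) {r : ℤ} (hr : r ≠ 0) :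
    {t : ℂ | t ≠ 0 ∧ Q * t ^ r = w}.Finite := by
  have key : ∀ (m : ℕ) (w : ℂ), m ≠ 0 → {t : ℂ | t ^ m = w}.Finite := by
    intro m w hm
    have hpoly : (Polynomial.X ^ m - Polynomial.C w : Polynomial ℂ) ≠ 0 :=
      Polynomial.X_pow_sub_C_ne_zero (Nat.pos_of_ne_zero hm) w
    refine (Polynomial.finite_setOfPred_isRoot hpoly).subset fun t ht => ?_
    simp only [Set.mem_ofPred_eq] at ht
    simp [ht]
  obtain ⟨m, rfl | rfl⟩ := r.eq_nat_or_neg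
  · refine (key m (w / Q) (by simpa using hr)).subset fun t ht => ?_
    simp only [Set.mem_ofPred_eq, zpow_natCast] at ht ⊢
    rw [← ht.2]; field_simp
  · refine (key m (Q / w) (by simpa using hr)).subset fun t ht => ?_
    simp only [Set.mem_ofPred_eq, zpow_neg, zpow_natCast] at ht ⊢
    have ht0 : t ^ m ≠ 0 := pow_ne_zero _ ht.1
    rw [← ht.2]; field_simp

lemma eventually_cocountable_ne_zero : ∀ᶠ t : ℂ in cocountable, t ≠ 0 := by
  rw [Filter.Eventually, mem_cocountable]
  refine (Set.countable_singleton (0 : ℂ)).mono fun t ht => ?_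
  simpa using ht

/-- Because `r ≠ 0`, each zero of the theta function is hit by finitely many `t ≠ 0`. There are
countably many zeros and countably many `z`. -/
lemma eventually_cocountable_ellE_ne_zero (hp : ‖p‖ < 1) (hq : q ≠ 0) {Q : ℂ} (hQ : Q ≠ 0) {r : ℤ}
    (hr : r ≠ 0) : ∀ᶠ t : ℂ in cocountable, ∀ z : ℤ, ellE p (Q * t ^ r * q ^ z) ≠ 0 := by
  rw [eventually_countable_forall]
  intro z
  have hz : Q * q ^ z ≠ 0 := mul_ne_zero hQ (zpow_ne_zero _ hq)
  rw [Filter.Eventually, mem_cocountable]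
  refine ((Set.countable_singleton (0 : ℂ)).union
    ((countable_setOf_ellE_eq_zero hp).biUnion fun w _ =>
      (finite_setOf_mul_zpow_eq hz hr (w := w)).countable)).mono fun t ht => ?_
  simp only [Set.mem_compl_iff, Set.mem_ofPred_eq, not_not] at ht
  by_cases h0 : t = 0
  · exact Or.inl h0
  · refine Or.inr (Set.mem_biUnion (x := Q * t ^ r * q ^ z) ht ?_)
    exact ⟨h0, by ring⟩

lemma eq_of_eventually_cocountable {f g : ℂ → ℂ} {t : ℂ} (hf : ContinuousAt f t)
    (hg : ContinuousAt g t) (h : ∀ᶠ s in cocountable, f s = g s) : f t = g t := by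
  rw [Filter.Eventually, mem_cocountable] at h
  have hd := h.dense_compl ℂ
  rw [compl_compl] at hd
  exact tendsto_nhds_unique_of_frequently_eq hf hg (mem_closure_iff_frequently.1 (hd t))

/-- The exponents `2, 4, 0, -6` of `b, c, d, e` sum to zero, so balancing survives. With exponent
`1` for every `x i`, the nine generic quantities scale by `t` to the powers `2, 5, -5, -1, -3, 1, 7,
6, -2`, none of them zero. -/
lemma eventually_jacksonGeneric (hp : ‖p‖ < 1) (hq : q ≠ 0) {a b c d e : ℂ} {n : ℕ}
    {x : Fin n → ℂ} (ha : a ≠ 0) (hb : b ≠ 0) (hc : c ≠ 0) (hd : d ≠ 0) (he : e ≠ 0)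
    (hx : ∀ i, x i ≠ 0) : ∀ᶠ t : ℂ in cocountable,
      JacksonGeneric p q a (b * t ^ 2) (c * t ^ 4) d (e * (t ^ 6)⁻¹) fun i => x i * t := by
  have H : ∀ {Q : ℂ} (r : ℤ), Q ≠ 0 → r ≠ 0 →
      ∀ᶠ t : ℂ in cocountable, ∀ z : ℤ, ellE p (Q * t ^ r * q ^ z) ≠ 0 :=
    fun r hQ hr => eventually_cocountable_ellE_ne_zero hp hq hQ hr
  have h1 := eventually_countable_forall.2 fun i =>
    H 2 (mul_ne_zero ha (pow_ne_zero 2 (hx i))) (by norm_num)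
  have h2 := eventually_countable_forall.2 fun i => H 5 (mul_ne_zero hc (hx i)) (by norm_num)
  have h3 := eventually_countable_forall.2 fun i => H (-5) (mul_ne_zero he (hx i)) (by norm_num)
  have h4 := eventually_countable_forall.2 fun i =>
    H (-1) (div_ne_zero (mul_ne_zero ha (hx i)) hb) (by norm_num)
  have h5 := eventually_countable_forall.2 fun i =>
    H (-3) (div_ne_zero (mul_ne_zero ha (hx i)) hc) (by norm_num)
  have h6 := eventually_countable_forall.2 fun i =>
    H 1 (div_ne_zero (mul_ne_zero ha (hx i)) hd) (by norm_num)
  have h7 := eventually_countable_forall.2 fun i =>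
    H 7 (div_ne_zero (mul_ne_zero ha (hx i)) he) (by norm_num)
  have h8 := H 6 (mul_ne_zero (mul_ne_zero hb hc) (inv_ne_zero ha)) (by norm_num)
  have h9 := H (-2) (div_ne_zero hb hc) (by norm_num)
  have z1 : ∀ (t : ℂ) (m : ℕ), t ^ (-(m : ℤ)) = (t ^ m)⁻¹ := fun t m => by
    rw [zpow_neg, zpow_natCast]
  have z2 : ∀ (t : ℂ) (m : ℕ), t ^ (m : ℤ) = t ^ m := fun t m => zpow_natCast t m
  filter_upwards [eventually_cocountable_ne_zero, h1, h2, h3, h4, h5, h6, h7, h8, h9] with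
    t t0 h1 h2 h3 h4 h5 h6 h7 h8 h9
  refine ⟨fun i z => ?_, fun i z => ?_, fun i z => ?_, fun i z => ?_, fun i z => ?_,
    fun i z => ?_, fun i z => ?_, fun z => ?_, fun z => ?_⟩
  · convert! h1 i z using 3
    rw [show (2 : ℤ) = (2 : ℕ) from rfl, z2]; ring
  · convert! h2 i z using 3
    rw [show (5 : ℤ) = (5 : ℕ) from rfl, z2]; ring
  · convert! h3 i z using 3
    rw [show (-5 : ℤ) = -(5 : ℕ) from rfl, z1]; field_simp
  · convert! h4 i z using 3
    rw [show (-1 : ℤ) = -(1 : ℕ) from rfl, z1]; field_simp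
  · convert! h5 i z using 3
    rw [show (-3 : ℤ) = -(3 : ℕ) from rfl, z1]; field_simp
  · convert! h6 i z using 3
    rw [zpow_one]; ring
  · convert! h7 i z using 3
    rw [show (7 : ℤ) = (7 : ℕ) from rfl, z2]; field_simp
  · convert! h8 z using 3
    rw [show (6 : ℤ) = (6 : ℕ) from rfl, z2]; ring
  · convert! h9 z using 3
    rw [show (-2 : ℤ) = -(2 : ℕ) from rfl, z1]; field_simp

lemma continuousAt_ellJacksonSum (hp : ‖p‖ < 1) (hq : q ≠ 0) {a b c d e : ℂ} {n N : ℕ}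
    {x : Fin n → ℂ} (ha : a ≠ 0) (hb : b ≠ 0) (hc : c ≠ 0) (hd : d ≠ 0) (he : e ≠ 0)
    (hx : ∀ i, x i ≠ 0)
    (hden_pair : ∀ i j : Fin n, i < j →
      ellE p (x i / x j) ≠ 0 ∧ ellE p (a * x i * x j * q ^ N) ≠ 0)
    (hden_vwp : ∀ i, ellE p (a * x i ^ 2) ≠ 0)
    (hden_sum : ∀ i, ellPochs q p [q, a * q * x i / b, a * q * x i / c, a * q * x i / d,
      a * q * x i / e, a * x i ^ 2 * q ^ (N + 1)] N ≠ 0) :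
    ContinuousAt (fun t : ℂ => ellJacksonSum n N p q a (b * t ^ 2) (c * t ^ 4) d (e * (t ^ 6)⁻¹)
      fun i => x i * t) 1 := by
  have hE : ∀ {f : ℂ → ℂ}, ContinuousAt f 1 → f 1 ≠ 0 → ContinuousAt (fun t => ellE p (f t)) 1 :=
    fun {f} hf h0 => (continuousAt_ellE hp h0).comp hf
  refine tendsto_finsetSum _ fun k hk => ?_
  refine Tendsto.mul (tendsto_finsetProd _ fun i _ => tendsto_finsetProd _ fun j hj => ?_)
    (tendsto_finsetProd _ fun i _ => ?_)
  · have h := hden_pair i j (Finset.mem_Ioi.1 hj)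
    have hi := hx i
    have hj := hx j
    refine ContinuousAt.mul (ContinuousAt.div (hE ?_ ?_) (hE ?_ ?_) ?_)
      (ContinuousAt.div (hE ?_ ?_) (hE ?_ ?_) ?_)
    · fun_prop (disch := simpa)
    · simp [hi, hj, zpow_ne_zero _ hq]
    · fun_prop (disch := simpa)
    · simp [hi, hj]
    · simpa using h.1
    · fun_prop
    · simp [hi, hj, ha, hq]
    · fun_prop
    · simp [hi, hj, ha, hq]
    · simpa using h.2
  · have hi := hx i
    -- A shifted factorial of length `k i` is a partial product of the one of length `N`, so the
    -- assumed nonvanishing at length `N` suffices.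
    have hki : k i ≤ N := by
      have := Fintype.mem_piFinset.1 hk i
      exact Nat.lt_succ_iff.1 (Finset.mem_range.1 this)
    refine ContinuousAt.mul (ContinuousAt.div (hE ?_ ?_) (hE ?_ ?_) ?_)
      (ContinuousAt.div (ContinuousAt.mul (continuousAt_ellPochs hp hq
        [fun t => a * (x i * t) ^ 2, fun t => b * t ^ 2 * (x i * t), fun t => c * t ^ 4 * (x i * t),
          fun t => d * (x i * t), fun t => e * (t ^ 6)⁻¹ * (x i * t), fun _ => q ^ (-(N : ℤ))] _ ?_)
            continuousAt_const)
        (continuousAt_ellPochs hp hq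
          [fun _ => q, fun t => a * q * (x i * t) / (b * t ^ 2),
            fun t => a * q * (x i * t) / (c * t ^ 4), fun t => a * q * (x i * t) / d,
            fun t => a * q * (x i * t) / (e * (t ^ 6)⁻¹),
            fun t => a * (x i * t) ^ 2 * q ^ (N + 1)] _ ?_) ?_)
    · fun_prop
    · simp [hi, ha, hq]
    · fun_prop
    · simp [hi, ha]
    · simpa using hden_vwp i
    · simp only [List.forall_mem_cons]
      refine ⟨⟨?_, ?_⟩, ⟨?_, ?_⟩, ⟨?_, ?_⟩, ⟨?_, ?_⟩, ⟨?_, ?_⟩, ⟨?_, ?_⟩, by simp⟩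
      all_goals first
        | fun_prop (disch := simp [*])
        | simp [ha, hb, hc, hd, he, hi, hq]
    · simp only [List.forall_mem_cons]
      refine ⟨⟨?_, ?_⟩, ⟨?_, ?_⟩, ⟨?_, ?_⟩, ⟨?_, ?_⟩, ⟨?_, ?_⟩, ⟨?_, ?_⟩, by simp⟩
      all_goals first
        | fun_prop (disch := simp [*])
        | simp [ha, hb, hc, hd, he, hi, hq]
    · simpa using ellPochs_ne_zero_of_le (hden_sum i) hki

lemma continuousAt_ellJacksonProd (hp : ‖p‖ < 1) (hq : q ≠ 0) {a b c d : ℂ} {n N : ℕ}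
    {x : Fin n → ℂ} (ha : a ≠ 0) (hb : b ≠ 0) (hc : c ≠ 0) (hd : d ≠ 0) (hx : ∀ i, x i ≠ 0)
    (hden_prod : ∀ i, ellPochs q p [a * q ^ (2 - (n : ℤ)) / (b * c * d * x i),
      a * q * x i / b, a * q * x i / c, a * q * x i / d] N ≠ 0) :
    ContinuousAt (fun t : ℂ => ellJacksonProd n N p q a (b * t ^ 2) (c * t ^ 4) d
      fun i => x i * t) 1 := by
  refine tendsto_finsetProd _ fun i _ => ?_
  have hi := hx i
  refine ContinuousAt.div (continuousAt_ellPochs hp hq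
    [fun t => a * q * (x i * t) ^ 2,
      fun t => a * q ^ (2 - (((i : ℕ) : ℤ) + 1)) / (b * t ^ 2 * (c * t ^ 4)),
      fun t => a * q ^ (2 - (((i : ℕ) : ℤ) + 1)) / (b * t ^ 2 * d),
      fun t => a * q ^ (2 - (((i : ℕ) : ℤ) + 1)) / (c * t ^ 4 * d)] _ ?_)
    (continuousAt_ellPochs hp hq
      [fun t => a * q ^ (2 - (n : ℤ)) / (b * t ^ 2 * (c * t ^ 4) * d * (x i * t)),
        fun t => a * q * (x i * t) / (b * t ^ 2),
        fun t => a * q * (x i * t) / (c * t ^ 4), fun t => a * q * (x i * t) / d] _ ?_) ?_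
  · simp only [List.forall_mem_cons]
    refine ⟨⟨?_, ?_⟩, ⟨?_, ?_⟩, ⟨?_, ?_⟩, ⟨?_, ?_⟩, by simp⟩
    all_goals first
      | fun_prop (disch := simp [*])
      | simp [ha, hb, hc, hd, hi, hq, zpow_ne_zero]
  · simp only [List.forall_mem_cons]
    refine ⟨⟨?_, ?_⟩, ⟨?_, ?_⟩, ⟨?_, ?_⟩, ⟨?_, ?_⟩, by simp⟩
    all_goals first
      | fun_prop (disch := simp [*])
      | simp [ha, hb, hc, hd, hi, hq, zpow_ne_zero]
  · simpa using hden_prod i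

end Perturbation

/-! ### The summation formula -/

theorem mainTheorem1 (n N : ℕ) (p q a b c d e : ℂ) (x : Fin n → ℂ)
    (hp : ‖p‖ < 1) (hq : q ≠ 0)
    (ha : a ≠ 0) (hb : b ≠ 0) (hc : c ≠ 0) (hd : d ≠ 0) (he : e ≠ 0) (hx : ∀ i, x i ≠ 0)
    (hbal : a ^ 2 * q ^ ((N : ℤ) - (n : ℤ) + 2) = b * c * d * e)
    -- no denominator in the identity vanishes
    (hden_pair : ∀ i j : Fin n, i < j →
      ellE p (x i / x j) ≠ 0 ∧ ellE p (a * x i * x j * q ^ N) ≠ 0)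
    (hden_vwp : ∀ i, ellE p (a * x i ^ 2) ≠ 0)
    (hden_sum : ∀ i, ellPochs q p [q, a * q * x i / b, a * q * x i / c, a * q * x i / d,
      a * q * x i / e, a * x i ^ 2 * q ^ (N + 1)] N ≠ 0)
    (hden_prod : ∀ i, ellPochs q p [a * q ^ (2 - (n : ℤ)) / (b * c * d * x i),
      a * q * x i / b, a * q * x i / c, a * q * x i / d] N ≠ 0) :
    ∑ k ∈ Fintype.piFinset (fun _ : Fin n => Finset.range (N + 1)),
      (∏ i : Fin n, ∏ j ∈ Finset.Ioi i,
        (ellE p (q ^ ((k i : ℤ) - (k j : ℤ)) * x i / x j) / ellE p (x i / x j) *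
          (ellE p (a * x i * x j * q ^ (k i + k j)) / ellE p (a * x i * x j * q ^ N)))) *
      ∏ i : Fin n,
        (ellE p (a * x i ^ 2 * q ^ (2 * k i)) / ellE p (a * x i ^ 2) *
          (ellPochs q p [a * x i ^ 2, b * x i, c * x i, d * x i, e * x i, q ^ (-(N : ℤ))] (k i) *
              q ^ (((i : ℕ) + 1) * k i) /
            ellPochs q p [q, a * q * x i / b, a * q * x i / c, a * q * x i / d,
              a * q * x i / e, a * x i ^ 2 * q ^ (N + 1)] (k i))) =
    ∏ i : Fin n,
      (ellPochs q p [a * q * x i ^ 2,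
          a * q ^ (2 - (((i : ℕ) : ℤ) + 1)) / (b * c),
          a * q ^ (2 - (((i : ℕ) : ℤ) + 1)) / (b * d),
          a * q ^ (2 - (((i : ℕ) : ℤ) + 1)) / (c * d)] N /
        ellPochs q p [a * q ^ (2 - (n : ℤ)) / (b * c * d * x i),
          a * q * x i / b, a * q * x i / c, a * q * x i / d] N) := by
  change ellJacksonSum n N p q a b c d e x = ellJacksonProd n N p q a b c d x
  have h := eq_of_eventually_cocountable
    (continuousAt_ellJacksonSum hp hq ha hb hc hd he hx hden_pair hden_vwp hden_sum)
    (continuousAt_ellJacksonProd hp hq ha hb hc hd hx hden_prod) ?_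
  · simpa using h
  -- The ratios `x i / x j` do not move with `t`, whereas `a * x i * x j` scales by `t ^ 2` and
  -- needs its own genericity.
  have hpair := eventually_countable_forall.2 fun i => eventually_countable_forall.2
    fun j => eventually_cocountable_ellE_ne_zero hp hq (r := 2)
      (mul_ne_zero (mul_ne_zero ha (hx i)) (hx j)) (by norm_num)
  filter_upwards [eventually_cocountable_ne_zero, hpair,
    eventually_jacksonGeneric hp hq ha hb hc hd he hx] with t ht hpair hg
  refine ellJacksonSum_eq_ellJacksonProd_of_generic hp hq ha (mul_ne_zero hb (pow_ne_zero _ ht))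
    (mul_ne_zero hc (pow_ne_zero _ ht)) hd (mul_ne_zero he (inv_ne_zero (pow_ne_zero _ ht)))
    (fun i => mul_ne_zero (hx i) ht) ?_ ?_ ?_ hg
  · rw [hbal]
    field_simp
  -- The nonvanishing of `(q)_N` is read off from a row, which exists only for `n ≠ 0`.
  · intro hn
    have h0 := hden_sum ⟨0, Nat.pos_of_ne_zero hn⟩
    simp only [ellPochs, List.map_cons, List.prod_cons] at h0
    exact left_ne_zero_of_mul h0
  · intro i j hij
    refine ⟨?_, ?_⟩
    · rw [mul_div_mul_right _ _ ht]
      exact (hden_pair i j hij).1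
    · have h2 := hpair i j N
      rwa [zpow_natCast, show a * x i * x j * t ^ (2 : ℤ) * q ^ N =
        a * (x i * t) * (x j * t) * q ^ N by
          rw [show (2 : ℤ) = (2 : ℕ) from rfl, zpow_natCast]; ring] at h2
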